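/- Let $M$ be a connected smooth manifold. A Finsler spacetime $(M,L)$ consists of a connected open conic set $A\subset TM\setminus\mathbf 0$ with smooth boundary and with $A_p=A\cap T_pM\neq\emptyset$ for all $p$, and of a smooth function $L\colon\bar A\to[0,\infty)$ on the closure $\bar A$ of $A$ in $TM\setminus\mathbf 0$, such that $L(\lambda v)=\lambda^2L(v)$ for $\lambda>0$, the fundamental tensor $g_v(u,w)=\frac12\frac{\partial^2}{\partial s\partial t}L(v+tu+sw)|_{t=s=0}$ has signature $(+,-,\dots,-)$ for every $v\in\bar A$, and the boundary of $\bar A$ in $TM\setminus\mathbf 0$ is $L^{-1}(0)$. Let $C_v(u,w,z)=\frac14\frac{\partial^3}{\partial r\partial s\partial t}L(v+tu+sw+rz)|_{t=s=r=0}$ be the Cartan tensor. For an open set $\mathscr U\subseteq M$ and a smooth vector field $V$ on $\mathscr U$ with values in $\bar A$, the Levi-Civita–Chern connection $\nabla^V$ is the unique torsion-free affine connection on $\mathscr U$ with $$X(g_V(Y,Z))=g_V(\nabla^V_XY,Z)+g_V(Y,\nabla^V_XZ)+2C_V(\nabla^V_XV,Y,Z)\quad\text{for all }X,Y,Z\in\mathfrak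 X(\mathscr U).$$ Let $f\colon\mathscr U\to\mathbb R$ be smooth and let $N=\nabla f$ be its gradient, i.e. $N$ is a smooth vector field on $\mathscr U$ with values in $\bar A$ and $g_N(N,X)=df(X)$ for all $X\in\mathfrak X(\mathscr U)$. Suppose that $N$ is lightlike ($L(N)=0$) and parallel ($\nabla^N_XN=0$ for all $X\in\mathfrak X(\mathscr U)$). Let $N^\perp\subseteq T\mathscr U$ be the $g_N$-orthogonal complement of $N$. Then: 1. the vector bundle $N^\perp/N$ over $\mathscr U$ carries a well-defined smooth positive-definite metric $\bar g([X],[Y]):=-g_N(X,Y)$; 2. $N^\perp/N$ carries a well-defined linear connection $\overline\nabla\colon\mathfrak X(\mathscr U)\times\Gamma(N^\perp/N)\to\Gamma(N^\perp/N)$, $\overline\nabla_W[Y]:=[\nabla^N_WY]$ (in particular $\nabla^N_WY\in\Gamma(N^\perp)$ for all $W\in\mathfrak X(\mathscr U)$ and $Y\in\Gamma(N^\perp)$); 3. $\overline\nabla$ is flat if and only if $(\mathscr U,L|_{\mathscr U})$ is a Finsler pp-wave with respect to $N$, that is, the curvature $R_N$ satisfies $R_N(X,Y)Z=0$ for all $X,Y,Z\in\Gamma(N^\perp)$.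 (Since $N$ is parallel, the Chern curvature $R_N$ at $N$ is the curvature tensor of $\nabla^N$.) -/

import Mathlib

open Bundle Set TopologicalSpace
open scoped Manifold ContDiff Topology

noncomputable section

namespace FinslerPP

section Cone

variable {E : Type*} [NormedAddCommGroup E] [NormedSpace ℝ E]
  {M : Type*} [TopologicalSpace M] [ChartedSpace E M]
  [IsManifold 𝓘(ℝ, E) ∞ M]

/-- The closure of a set `A ⊆ TM ∖ 0` of tangent vectors, taken in the slit tangent bundle
`TM ∖ 0`. -/
def slitClosure (A : Set (TangentBundle 𝓘(ℝ, E) M)) : Set (TangentBundle 𝓘(ℝ, E) M) :=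
  closure A \ {v | v.2 = 0}

/-- The fundamental tensor `g_v(u, w) = ½ ∂²/∂s∂t L(v + t u + s w)` at `t = s = 0`, written as half
the second derivative of `L` on the tangent space `T_{π(v)}M` (which is modelled on `E`). -/
def fundamentalTensor (L : TangentBundle 𝓘(ℝ, E) M → ℝ) (v : TangentBundle 𝓘(ℝ, E) M) :
    E →L[ℝ] E →L[ℝ] ℝ :=
  (1 / 2 : ℝ) • fderiv ℝ (fderiv ℝ (fun y : E => L ⟨v.1, y⟩)) v.2

/-- The Cartan tensor `C_v(u, w, z) = ¼ ∂³/∂r∂s∂t L(v + t u + s w + r z)` at `t = s = r = 0`. -/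
def cartanTensor (L : TangentBundle 𝓘(ℝ, E) M → ℝ) (v : TangentBundle 𝓘(ℝ, E) M) :
    E →L[ℝ] E →L[ℝ] E →L[ℝ] ℝ :=
  (1 / 4 : ℝ) • fderiv ℝ (fderiv ℝ (fderiv ℝ (fun y : E => L ⟨v.1, y⟩))) v.2

/-- A bilinear form has signature `(+, -, …, -)`: it is positive on some vector and negative
definite on the orthogonal complement of that vector. -/
def HasLorentzSignature (b : E →L[ℝ] E →L[ℝ] ℝ) : Prop :=
  ∃ u, 0 < b u u ∧ ∀ w, b u w = 0 → w ≠ 0 → b w w < 0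

end Cone

/-- A Finsler spacetime `(M, L)`: a connected open cone `A ⊆ TM ∖ 0` with smooth boundary and
nonempty fibres, and a nonnegative smooth function `L` on its closure `Ā` in `TM ∖ 0`, positively
homogeneous of degree two, whose fundamental tensor has signature `(+, -, …, -)` on `Ā` and whose
zero set is the boundary of `Ā`.

The function `L` is recorded together with a smooth extension to an open neighbourhood of `Ā`
(smoothness on the manifold with boundary `Ā` means that there is one). Apart from the existence of
the extension, only the values on `Ā` are constrained, and the derivatives of `L` at points of `Ā`
do not depend on the extension. -/
structure FinslerSpacetime (E : Type*) [NormedAddCommGroup E] [NormedSpace ℝ E]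
    (M : Type*) [TopologicalSpace M] [ChartedSpace E M] [IsManifold 𝓘(ℝ, E) ∞ M] where
  A : Set (TangentBundle 𝓘(ℝ, E) M)
  L : TangentBundle 𝓘(ℝ, E) M → ℝ
  isOpen_A : IsOpen A
  isConnected_A : IsConnected A
  ne_zero : ∀ v ∈ A, v.2 ≠ 0
  conic : ∀ v ∈ A, ∀ c : ℝ, 0 < c → (⟨v.1, c • v.2⟩ : TangentBundle 𝓘(ℝ, E) M) ∈ A
  nonempty_fibre : ∀ p : M, ∃ v ∈ A, v.1 = p
  /-- Near each of its boundary points in `TM ∖ 0`, the set `A` is `{φ > 0}` for a smooth function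
  `φ` whose differential does not vanish at the point. -/
  smooth_boundary : ∀ v ∈ slitClosure A \ A,
    ∃ (W : Set (TangentBundle 𝓘(ℝ, E) M)) (φ : TangentBundle 𝓘(ℝ, E) M → ℝ),
      IsOpen W ∧ v ∈ W ∧ ContMDiffOn 𝓘(ℝ, E).tangent 𝓘(ℝ, ℝ) ∞ φ W ∧
      mfderiv 𝓘(ℝ, E).tangent 𝓘(ℝ, ℝ) φ v ≠ 0 ∧ ∀ w ∈ W, w ∈ A ↔ 0 < φ w
  smooth_L : ∃ Ω : Set (TangentBundle 𝓘(ℝ, E) M), IsOpen Ω ∧ slitClosure A ⊆ Ω ∧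
    ContMDiffOn 𝓘(ℝ, E).tangent 𝓘(ℝ, ℝ) ∞ L Ω
  nonneg_L : ∀ v ∈ slitClosure A, 0 ≤ L v
  homogeneous_L : ∀ v ∈ slitClosure A, ∀ c : ℝ, 0 < c → L ⟨v.1, c • v.2⟩ = c ^ 2 * L v
  signature : ∀ v ∈ slitClosure A, HasLorentzSignature (fundamentalTensor L v)
  lightcone : ∀ v ∈ slitClosure A, L v = 0 ↔ v ∈ frontier (slitClosure A)

section Fields

variable {E : Type*} [NormedAddCommGroup E] [NormedSpace ℝ E]
  {M : Type*} [TopologicalSpace M] [ChartedSpace E M] [IsManifold 𝓘(ℝ, E) ∞ M]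

/-- The functions that are smooth on `U`, as a subalgebra of all functions on `M`. -/
def smoothSubalgebra (E : Type*) [NormedAddCommGroup E] [NormedSpace ℝ E]
    {M : Type*} [TopologicalSpace M] [ChartedSpace E M] (U : Opens M) : Subalgebra ℝ (M → ℝ) where
  carrier := {f | ContMDiffOn 𝓘(ℝ, E) 𝓘(ℝ, ℝ) ∞ f U}
  mul_mem' hf hg := ContMDiffOn.mul hf hg
  add_mem' hf hg := ContMDiffOn.add hf hg
  algebraMap_mem' _ := contMDiffOn_const

/-- The ring of smooth functions on `U`. Its elements are functions on `M` that are smooth on `U`;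
their values outside `U` play no role. -/
def SmoothFun (E : Type*) [NormedAddCommGroup E] [NormedSpace ℝ E]
    {M : Type*} [TopologicalSpace M] [ChartedSpace E M] (U : Opens M) : Type _ :=
  smoothSubalgebra E U

instance (U : Opens M) : CommRing (SmoothFun E U) :=
  inferInstanceAs (CommRing (smoothSubalgebra E U))

instance (U : Opens M) : FunLike (SmoothFun E U) M ℝ where
  coe := Subtype.val
  coe_injective := Subtype.val_injective

/-- The smooth vector fields on `U`, extended by zero to `M`, as an additive group. -/
def fieldSubgroup (E : Type*) [NormedAddCommGroup E] [NormedSpace ℝ E]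
    {M : Type*} [TopologicalSpace M] [ChartedSpace E M] [IsManifold 𝓘(ℝ, E) ∞ M] (U : Opens M) :
    AddSubgroup ((p : M) → TangentSpace 𝓘(ℝ, E) p) where
  carrier := {X | ContMDiffOn 𝓘(ℝ, E) 𝓘(ℝ, E).tangent ∞
      (fun p => (⟨p, X p⟩ : TangentBundle 𝓘(ℝ, E) M)) U ∧ ∀ p ∉ U, X p = 0}
  add_mem' {X Y} hX hY :=
    ⟨hX.1.add_section hY.1, fun p hp => by simp [hX.2 p hp, hY.2 p hp]⟩
  zero_mem' := ⟨(contMDiff_zeroSection ℝ (TangentSpace 𝓘(ℝ, E) : M → Type _) (F := E)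
      (IB := 𝓘(ℝ, E)) (n := ∞)).contMDiffOn, fun p _ => rfl⟩
  neg_mem' {X} hX := ⟨hX.1.neg_section, fun p hp => by simp [hX.2 p hp]⟩

/-- The space `𝔛(U)` of smooth vector fields on `U`. A vector field on `U` is represented by its
extension by zero to `M`. -/
def VectorFields (E : Type*) [NormedAddCommGroup E] [NormedSpace ℝ E]
    {M : Type*} [TopologicalSpace M] [ChartedSpace E M] [IsManifold 𝓘(ℝ, E) ∞ M] (U : Opens M) :
    Type _ :=
  fieldSubgroup E U

instance (U : Opens M) : AddCommGroup (VectorFields E U) :=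
  inferInstanceAs (AddCommGroup (fieldSubgroup E U))

instance (U : Opens M) : DFunLike (VectorFields E U) M (TangentSpace 𝓘(ℝ, E)) where
  coe := Subtype.val
  coe_injective := Subtype.val_injective

theorem VectorFields.contMDiffOn {U : Opens M} (X : VectorFields E U) :
    ContMDiffOn 𝓘(ℝ, E) 𝓘(ℝ, E).tangent ∞
      (fun p => (⟨p, X p⟩ : TangentBundle 𝓘(ℝ, E) M)) U := X.2.1

theorem VectorFields.eq_zero {U : Opens M} (X : VectorFields E U) (p : M) (hp : p ∉ U) :
    X p = 0 := X.2.2 p hp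

/-- Smooth functions on `U` act on vector fields on `U` by pointwise multiplication. -/
instance (U : Opens M) : SMul (SmoothFun E U) (VectorFields E U) where
  smul f X := ⟨fun p => f p • X p, ContMDiffOn.smul_section f.2 X.contMDiffOn, fun p hp => by
    simp [X.eq_zero p hp]⟩

instance (U : Opens M) : Module (SmoothFun E U) (VectorFields E U) where
  one_smul X := DFunLike.ext _ _ (fun p => one_smul ℝ (X p))
  mul_smul f f' X := DFunLike.ext _ _ (fun p => mul_smul (f p) (f' p) (X p))
  smul_zero f := DFunLike.ext _ _ (fun p => smul_zero (f p))
  smul_add f X Y := DFunLike.ext _ _ (fun p => smul_add (f p) (X p) (Y p))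
  add_smul f f' X := DFunLike.ext _ _ (fun p => add_smul (f p) (f' p) (X p))
  zero_smul X := DFunLike.ext _ _ (fun p => zero_smul ℝ (X p))

/-- The derivative `X(f) = df(X)`. -/
def dirDeriv {U : Opens M} (X : VectorFields E U) (f : SmoothFun E U) : SmoothFun E U :=
  ⟨fun p => mfderiv 𝓘(ℝ, E) 𝓘(ℝ, ℝ) f p (X p), by
    have hU : UniqueMDiffOn 𝓘(ℝ, E) (U : Set M) := U.isOpen.uniqueMDiffOn
    have h1 := ContMDiffOn.contMDiffOn_tangentMapWithin (m := ∞) (n := ∞) f.2 (by simp) hU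
    have h2 := h1.comp X.contMDiffOn (fun p hp => hp)
    have h3 := (contMDiff_snd_tangentBundle_modelSpace ℝ 𝓘(ℝ, ℝ) (n := ∞)).comp_contMDiffOn h2
    refine h3.congr fun p hp => ?_
    exact congrArg (fun T : TangentSpace 𝓘(ℝ, E) p →L[ℝ] ℝ => T (X p))
      (mfderivWithin_of_isOpen U.isOpen hp).symm⟩

variable [FiniteDimensional ℝ E]

/-- The Lie bracket `[X, Y]` of smooth vector fields on `U`. -/
def lieBracket {U : Opens M} (X Y : VectorFields E U) : VectorFields E U :=
  ⟨fun p => open Classical in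
      if p ∈ U then VectorField.mlieBracket 𝓘(ℝ, E) X Y p else 0, by
    have : IsManifold 𝓘(ℝ, E) (((⊤ : ℕ∞) : WithTop ℕ∞) + 1) M := by simpa
    have : IsManifold 𝓘(ℝ, E) (minSmoothness ℝ 2) M :=
      IsManifold.of_le (n := ∞) (by
        rw [minSmoothness_of_isRCLikeNormedField]
        exact WithTop.coe_le_coe.2 (le_top : (2 : ℕ∞) ≤ ⊤))
    have : CompleteSpace E := FiniteDimensional.complete ℝ E
    have h := ContMDiffOn.mlieBracketWithin_vectorField (m := (⊤ : ℕ∞)) (n := (⊤ : ℕ∞))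
      X.contMDiffOn Y.contMDiffOn U.isOpen.uniqueMDiffOn (by simp)
    refine ⟨h.congr fun p hp => ?_, fun p hp => by simp [hp]⟩
    have hp' : p ∈ U := hp
    simp [hp', VectorField.mlieBracketWithin_of_isOpen U.isOpen hp]⟩

/-- `D` is a linear connection on a module `Γ` of sections over `U`: `D_W s` is linear over the
smooth functions in `W`, additive in `s`, and satisfies the Leibniz rule. -/
structure IsLinearConnection {U : Opens M} {Γ : Type*} [AddCommGroup Γ]
    [Module (SmoothFun E U) Γ] (D : VectorFields E U → Γ → Γ) : Prop where
  add_left : ∀ W W' s, D (W + W') s = D W s + D W' s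
  smul_left : ∀ (f : SmoothFun E U) W s, D (f • W) s = f • D W s
  add_right : ∀ W s s', D W (s + s') = D W s + D W s'
  leibniz : ∀ W (f : SmoothFun E U) s, D W (f • s) = f • D W s + dirDeriv W f • s

/-- The curvature `R(X, Y)s = D_X D_Y s - D_Y D_X s - D_{[X, Y]} s`. -/
def curvature {U : Opens M} {Γ : Type*} [AddCommGroup Γ]
    (D : VectorFields E U → Γ → Γ) (X Y : VectorFields E U) (s : Γ) : Γ :=
  D X (D Y s) - D Y (D X s) - D (lieBracket X Y) s

/-- A connection is flat if its curvature vanishes. -/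
def IsFlat {U : Opens M} {Γ : Type*} [AddCommGroup Γ]
    (D : VectorFields E U → Γ → Γ) : Prop :=
  ∀ X Y s, curvature D X Y s = 0

namespace FinslerSpacetime

variable (S : FinslerSpacetime E M) {U : Opens M}

/-- The closed cone `Ā` of causal vectors. -/
def causal : Set (TangentBundle 𝓘(ℝ, E) M) := slitClosure S.A

/-- `V` takes values in `Ā`. -/
def IsAdmissible (V : VectorFields E U) : Prop :=
  ∀ p ∈ U, (⟨p, V p⟩ : TangentBundle 𝓘(ℝ, E) M) ∈ S.causal

/-- The metric `g_V` on the tangent space at `p`. -/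
def g (V : VectorFields E U) (p : M) : LinearMap.BilinForm ℝ (TangentSpace 𝓘(ℝ, E) p) :=
  (fundamentalTensor S.L ⟨p, V p⟩).toBilinForm

/-- The Cartan tensor `C_V` on the tangent space at `p`. -/
def C (V : VectorFields E U) (p : M) (x y z : TangentSpace 𝓘(ℝ, E) p) : ℝ :=
  cartanTensor S.L ⟨p, V p⟩ x y z

/-- The characterization of the Levi-Civita–Chern connection `∇^V` of an admissible field `V`:
it is the affine connection on `U` that is torsion-free and almost `g`-compatible. -/
structure IsChernConnection (V : VectorFields E U)
    (D : VectorFields E U → VectorFields E U → VectorFields E U) :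
    Prop where
  linear : IsLinearConnection D
  torsion_free : ∀ X Y, D X Y - D Y X = lieBracket X Y
  almost_compatible : ∀ (X Y Z : VectorFields E U), ∀ p ∈ U,
    mfderiv 𝓘(ℝ, E) 𝓘(ℝ, ℝ) (fun q => S.g V q (Y q) (Z q)) p (X p) =
      S.g V p (D X Y p) (Z p) + S.g V p (Y p) (D X Z p)
        + 2 * S.C V p (D X V p) (Y p) (Z p)

/-- The Levi-Civita–Chern connection `∇^V`: *the* affine connection on `U` that is torsion-free and
almost `g`-compatible with respect to `V`. -/
def chern (V : VectorFields E U) :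
    VectorFields E U → VectorFields E U → VectorFields E U :=
  Classical.epsilon (S.IsChernConnection V)

/-- `N` is the gradient of `f` with respect to `L`: it is admissible and `g_N(N, ·) = df`. -/
def IsGradient (f : SmoothFun E U) (N : VectorFields E U) : Prop :=
  S.IsAdmissible N ∧ ∀ p ∈ U, ∀ x : TangentSpace 𝓘(ℝ, E) p,
    S.g N p (N p) x = mfderiv 𝓘(ℝ, E) 𝓘(ℝ, ℝ) (f : M → ℝ) p x

/-- `N` is lightlike: it takes values in the lightcone (and so vanishes nowhere on `U`). -/
def IsLightlike (N : VectorFields E U) : Prop :=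
  S.IsAdmissible N ∧ ∀ p ∈ U, S.L ⟨p, N p⟩ = 0

/-- `N` is parallel: `∇^N_X N = 0` for all vector fields `X` on `U`. -/
def IsParallel (N : VectorFields E U) : Prop :=
  ∀ X, S.chern N X N = 0

/-- The module `Γ(N^⊥)` of vector fields `X` on `U` with `g_N(N, X) = 0`. -/
def Perp (N : VectorFields E U) :
    Submodule (SmoothFun E U) (VectorFields E U) where
  carrier := {X | ∀ p ∈ U, S.g N p (N p) (X p) = 0}
  add_mem' {X Y} hX hY p hp :=
    (map_add (S.g N p (N p)) (X p) (Y p)).trans (by rw [hX p hp, hY p hp, add_zero])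
  zero_mem' p _ := map_zero (S.g N p (N p))
  smul_mem' f X hX p hp :=
    (map_smul (S.g N p (N p)) (f p) (X p)).trans (by rw [hX p hp, smul_zero])

/-- The module `Γ(N^⊥/N)` of sections of the quotient bundle: classes `[X]` of sections
`X ∈ Γ(N^⊥)`, where `[X] = [X']` means that `X' = X + f N` for a smooth function `f` on `U`. -/
abbrev QuotSections (N : VectorFields E U) :=
  S.Perp N ⧸ (Submodule.span (SmoothFun E U) {N}).submoduleOf (S.Perp N)

/-- The fibre of `N^⊥` at `p`. -/
def PerpFibre (N : VectorFields E U) (p : M) : Submodule ℝ (TangentSpace 𝓘(ℝ, E) p) :=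
  LinearMap.ker (S.g N p (N p))

/-- The fibre of the quotient bundle `N^⊥/N` at `p`. -/
abbrev QuotFibre (N : VectorFields E U) (p : M) :=
  S.PerpFibre N p ⧸ (Submodule.span ℝ {N p}).submoduleOf (S.PerpFibre N p)

/-- `(U, L|_U)` is a Finsler pp-wave with respect to `N`: the field `N` is a lightlike parallel
gradient field on `U`, and the Chern curvature satisfies `R_N(X, Y)Z = 0` for all
`X, Y, Z ∈ Γ(N^⊥)`. (As `N` is parallel, the Chern curvature tensor evaluated at `N` is the curvature
tensor of the affine connection `∇^N`.) -/
def IsPPWave (N : VectorFields E U) : Prop :=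
  (∃ f, S.IsGradient f N) ∧ S.IsLightlike N ∧ S.IsParallel N ∧
    ∀ X ∈ S.Perp N, ∀ Y ∈ S.Perp N, ∀ Z ∈ S.Perp N, curvature (S.chern N) X Y Z = 0

end FinslerSpacetime

end Fields

end FinslerPP

end

/-!
Since `N` is parallel, the Cartan term in the equation for `∇^N` vanishes, so `∇^N` is the
Levi-Civita connection of the metric `g_N` and its curvature has the symmetries of a Riemann tensor.
The connection on `N^⊥/N` is flat iff `R(X, Y)Z` is a multiple of `N` for all `X`, `Y` and all
`Z ⊥ N`, that is, iff `g_N(R(X, Y)Z, W) = 0` for all `X`, `Y` and all `Z, W ⊥ N`. By pair symmetry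
this says that `R(Z, W) = 0` for all `Z, W ⊥ N`; and a skew operator that vanishes on the hyperplane
`N^⊥` vanishes, so it suffices that `R(Z, W)` vanishes on `N^⊥`.

The connection `∇^V` exists because its defining equation is a Koszul formula with a Cartan term in
`∇V`, which can be solved first for `∇_V V`, where `C_V(V, ·, ·) = 0` removes that term, then for
`∇_X V`, and then for `∇_X Y`.
-/

noncomputable section

namespace FinslerPP

variable {E : Type*} [NormedAddCommGroup E] [NormedSpace ℝ E]
  {M : Type*} [TopologicalSpace M] [ChartedSpace E M] {U : Opens M}

/-! ### Functions, vector fields and their derivatives -/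

namespace SmoothFun

instance : Algebra ℝ (SmoothFun E U) := inferInstanceAs (Algebra ℝ (smoothSubalgebra E U))

@[ext] theorem ext {f h : SmoothFun E U} (H : ∀ p, f p = h p) : f = h := DFunLike.ext _ _ H

@[simp] theorem add_apply (f h : SmoothFun E U) (p : M) : (f + h) p = f p + h p := rfl
@[simp] theorem sub_apply (f h : SmoothFun E U) (p : M) : (f - h) p = f p - h p := rfl
@[simp] theorem mul_apply (f h : SmoothFun E U) (p : M) : (f * h) p = f p * h p := rfl
@[simp] theorem neg_apply (f : SmoothFun E U) (p : M) : (-f) p = -f p := rfl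
@[simp] theorem zero_apply (p : M) : (0 : SmoothFun E U) p = 0 := rfl
@[simp] theorem smul_apply (c : ℝ) (f : SmoothFun E U) (p : M) : (c • f) p = c * f p := rfl
@[simp] theorem algebraMap_apply (c : ℝ) (p : M) : algebraMap ℝ (SmoothFun E U) c p = c := rfl

/-- Evaluation at a point, as a homomorphism of algebras. -/
def eval (p : M) : SmoothFun E U →ₐ[ℝ] ℝ where
  toFun f := f p
  map_one' := rfl
  map_mul' _ _ := rfl
  map_zero' := rfl
  map_add' _ _ := rfl
  commutes' _ := rfl

@[simp] theorem eval_apply (p : M) (f : SmoothFun E U) : eval p f = f p := rfl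

@[simp] theorem sum_apply {ι : Type*} (s : Finset ι) (f : ι → SmoothFun E U) (p : M) :
    (∑ i ∈ s, f i) p = ∑ i ∈ s, f i p := map_sum (eval p) f s

theorem contMDiffAt (f : SmoothFun E U) {p : M} (hp : p ∈ U) :
    ContMDiffAt 𝓘(ℝ, E) 𝓘(ℝ, ℝ) ∞ f p :=
  ContMDiffOn.contMDiffAt f.2 (U.isOpen.mem_nhds hp)

theorem mdifferentiableAt (f : SmoothFun E U) {p : M} (hp : p ∈ U) :
    MDifferentiableAt 𝓘(ℝ, E) 𝓘(ℝ, ℝ) f p :=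
  (f.contMDiffAt hp).mdifferentiableAt (by simp)

/-- The smooth function given by a function on `M` that is smooth on `U`. -/
def mk (f : M → ℝ) (hf : ∀ p ∈ U, ContMDiffAt 𝓘(ℝ, E) 𝓘(ℝ, ℝ) ∞ f p) : SmoothFun E U :=
  ⟨f, fun p hp => (hf p hp).contMDiffWithinAt⟩

@[simp] theorem mk_apply (f : M → ℝ) (hf : ∀ p ∈ U, ContMDiffAt 𝓘(ℝ, E) 𝓘(ℝ, ℝ) ∞ f p) (p : M) :
    mk f hf p = f p := rfl

end SmoothFun

variable [IsManifold 𝓘(ℝ, E) ∞ M]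

namespace VectorFields

@[ext] theorem ext {X Y : VectorFields E U} (H : ∀ p, X p = Y p) : X = Y := DFunLike.ext _ _ H

theorem ext_on {X Y : VectorFields E U} (H : ∀ p ∈ U, X p = Y p) : X = Y := by
  ext p
  by_cases hp : p ∈ U
  · exact H p hp
  · rw [X.eq_zero p hp, Y.eq_zero p hp]

@[simp] theorem add_apply (X Y : VectorFields E U) (p : M) : (X + Y) p = X p + Y p := rfl
@[simp] theorem sub_apply (X Y : VectorFields E U) (p : M) : (X - Y) p = X p - Y p := rfl
@[simp] theorem neg_apply (X : VectorFields E U) (p : M) : (-X) p = -X p := rfl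
@[simp] theorem zero_apply (p : M) : (0 : VectorFields E U) p = 0 := rfl
@[simp] theorem smul_apply (f : SmoothFun E U) (X : VectorFields E U) (p : M) :
    (f • X) p = f p • X p := rfl

/-- Evaluation at a point, as an additive homomorphism. -/
def eval (p : M) : VectorFields E U →+ TangentSpace 𝓘(ℝ, E) p where
  toFun X := X p
  map_zero' := rfl
  map_add' _ _ := rfl

@[simp] theorem sum_apply {ι : Type*} (s : Finset ι) (X : ι → VectorFields E U) (p : M) :
    (∑ i ∈ s, X i) p = ∑ i ∈ s, X i p := map_sum (eval p) X s

theorem contMDiffAt (X : VectorFields E U) {p : M} (hp : p ∈ U) :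
    ContMDiffAt 𝓘(ℝ, E) 𝓘(ℝ, E).tangent ∞
      (fun p => (⟨p, X p⟩ : TangentBundle 𝓘(ℝ, E) M)) p :=
  X.contMDiffOn.contMDiffAt (U.isOpen.mem_nhds hp)

theorem mdifferentiableAt (X : VectorFields E U) {p : M} (hp : p ∈ U) :
    MDifferentiableAt 𝓘(ℝ, E) 𝓘(ℝ, E).tangent
      (fun p => (⟨p, X p⟩ : TangentBundle 𝓘(ℝ, E) M)) p :=
  (X.contMDiffAt hp).mdifferentiableAt (by simp)

open Classical in
/-- The vector field on `U` given by a section over `M` that is smooth on `U`. -/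
def mk (X : (p : M) → TangentSpace 𝓘(ℝ, E) p)
    (hX : ∀ p ∈ U, ContMDiffAt 𝓘(ℝ, E) 𝓘(ℝ, E).tangent ∞
      (fun p => (⟨p, X p⟩ : TangentBundle 𝓘(ℝ, E) M)) p) : VectorFields E U :=
  ⟨fun p => if p ∈ U then X p else 0,
    ContMDiffOn.congr (fun p hp => (hX p hp).contMDiffWithinAt) fun p hp => by
      simp only [if_pos (show p ∈ U from hp)],
    fun p hp => if_neg hp⟩

theorem mk_apply {X : (p : M) → TangentSpace 𝓘(ℝ, E) p}
    (hX : ∀ p ∈ U, ContMDiffAt 𝓘(ℝ, E) 𝓘(ℝ, E).tangent ∞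
      (fun p => (⟨p, X p⟩ : TangentBundle 𝓘(ℝ, E) M)) p) {p : M} (hp : p ∈ U) :
    mk X hX p = X p := if_pos hp

end VectorFields

theorem dirDeriv_apply (X : VectorFields E U) (f : SmoothFun E U) (p : M) :
    dirDeriv X f p = mfderiv 𝓘(ℝ, E) 𝓘(ℝ, ℝ) f p (X p) := rfl

theorem dirDeriv_apply_eq_zero {X : VectorFields E U} {p : M} (hX : X p = 0)
    (f : SmoothFun E U) : dirDeriv X f p = 0 := by
  rw [dirDeriv_apply, hX]
  exact map_zero _

theorem dirDeriv_add_left (X Y : VectorFields E U) (f : SmoothFun E U) :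
    dirDeriv (X + Y) f = dirDeriv X f + dirDeriv Y f := by
  ext p
  exact map_add (mfderiv 𝓘(ℝ, E) 𝓘(ℝ, ℝ) f p) (X p) (Y p)

theorem dirDeriv_smul_left (h : SmoothFun E U) (X : VectorFields E U) (f : SmoothFun E U) :
    dirDeriv (h • X) f = h * dirDeriv X f := by
  ext p
  exact map_smul (mfderiv 𝓘(ℝ, E) 𝓘(ℝ, ℝ) f p) (h p) (X p)

theorem dirDeriv_add (X : VectorFields E U) (f h : SmoothFun E U) :
    dirDeriv X (f + h) = dirDeriv X f + dirDeriv X h := by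
  ext p
  by_cases hp : p ∈ U
  · exact congr($(mfderiv_add (f.mdifferentiableAt hp) (h.mdifferentiableAt hp)) (X p))
  · simp [dirDeriv_apply_eq_zero (X.eq_zero p hp)]

theorem dirDeriv_zero (X : VectorFields E U) : dirDeriv X (0 : SmoothFun E U) = 0 :=
  map_zero (AddMonoidHom.mk' (dirDeriv X) (dirDeriv_add X))

theorem dirDeriv_mul (X : VectorFields E U) (f h : SmoothFun E U) :
    dirDeriv X (f * h) = f * dirDeriv X h + dirDeriv X f * h := by
  ext p
  by_cases hp : p ∈ U
  · have hmul := ((f.mdifferentiableAt hp).hasMFDerivAt.mul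
      (h.mdifferentiableAt hp).hasMFDerivAt).mfderiv
    refine congr($hmul (X p)).trans ?_
    rw [SmoothFun.add_apply, SmoothFun.mul_apply, SmoothFun.mul_apply, mul_comm (dirDeriv X f p)]
    rfl
  · simp [dirDeriv_apply_eq_zero (X.eq_zero p hp)]

section LieBracket

variable [FiniteDimensional ℝ E]

theorem lieBracket_apply (X Y : VectorFields E U) {p : M} (hp : p ∈ U) :
    lieBracket X Y p = VectorField.mlieBracket 𝓘(ℝ, E) X Y p := if_pos hp

theorem lieBracket_swap (X Y : VectorFields E U) : lieBracket X Y = -lieBracket Y X := by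
  refine VectorFields.ext_on fun p hp => ?_
  rw [VectorFields.neg_apply, lieBracket_apply _ _ hp, lieBracket_apply _ _ hp,
    VectorField.mlieBracket_swap_apply]

theorem lieBracket_add_right (X Y Z : VectorFields E U) :
    lieBracket X (Y + Z) = lieBracket X Y + lieBracket X Z := by
  have : CompleteSpace E := FiniteDimensional.complete ℝ E
  refine VectorFields.ext_on fun p hp => ?_
  rw [VectorFields.add_apply, lieBracket_apply _ _ hp, lieBracket_apply _ _ hp,
    lieBracket_apply _ _ hp]
  exact VectorField.mlieBracket_add_right (Y.mdifferentiableAt hp) (Z.mdifferentiableAt hp)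

theorem lieBracket_neg_right (X Y : VectorFields E U) :
    lieBracket X (-Y) = -lieBracket X Y :=
  map_neg (AddMonoidHom.mk' (lieBracket X) (lieBracket_add_right X)) Y

theorem lieBracket_smul_right (X : VectorFields E U) (f : SmoothFun E U) (Y : VectorFields E U) :
    lieBracket X (f • Y) = dirDeriv X f • Y + f • lieBracket X Y := by
  have : CompleteSpace E := FiniteDimensional.complete ℝ E
  refine VectorFields.ext_on fun p hp => ?_
  rw [VectorFields.add_apply, VectorFields.smul_apply, VectorFields.smul_apply,
    lieBracket_apply _ _ hp, lieBracket_apply _ _ hp]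
  exact VectorField.mlieBracket_smul_right (f.mdifferentiableAt hp) (Y.mdifferentiableAt hp)

theorem lieBracket_add_left (X Y Z : VectorFields E U) :
    lieBracket (X + Y) Z = lieBracket X Z + lieBracket Y Z := by
  rw [lieBracket_swap, lieBracket_add_right, lieBracket_swap X, lieBracket_swap Y, neg_add]

theorem lieBracket_smul_left (f : SmoothFun E U) (X Y : VectorFields E U) :
    lieBracket (f • X) Y = -dirDeriv Y f • X + f • lieBracket X Y := by
  rw [lieBracket_swap, lieBracket_smul_right, lieBracket_swap X Y, neg_add, neg_smul, smul_neg]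

theorem lieBracket_leibniz (X Y Z : VectorFields E U) :
    lieBracket X (lieBracket Y Z) =
      lieBracket (lieBracket X Y) Z + lieBracket Y (lieBracket X Z) := by
  have : CompleteSpace E := FiniteDimensional.complete ℝ E
  have : IsManifold 𝓘(ℝ, E) (minSmoothness ℝ 3) M := by
    rw [minSmoothness_of_isRCLikeNormedField]
    infer_instance
  have hsmooth (X : VectorFields E U) {p : M} (hp : p ∈ U) :
      ContMDiffAt 𝓘(ℝ, E) 𝓘(ℝ, E).tangent (minSmoothness ℝ 2)
        (fun p => (⟨p, X p⟩ : TangentBundle 𝓘(ℝ, E) M)) p := by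
    rw [minSmoothness_of_isRCLikeNormedField]
    exact (X.contMDiffAt hp).of_le ENat.LEInfty.out
  refine VectorFields.ext_on fun p hp => ?_
  have hcongr (A B : VectorFields E U) :
      (lieBracket A B : (p : M) → TangentSpace 𝓘(ℝ, E) p) =ᶠ[𝓝 p]
        VectorField.mlieBracket 𝓘(ℝ, E) A B := by
    filter_upwards [U.isOpen.mem_nhds hp] with q hq using lieBracket_apply A B hq
  rw [VectorFields.add_apply, lieBracket_apply _ _ hp, lieBracket_apply _ _ hp,
    lieBracket_apply _ _ hp, (Filter.EventuallyEq.refl _ X).mlieBracket_vectorField_eq (hcongr Y Z),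
    (hcongr X Y).mlieBracket_vectorField_eq (.refl _ Z),
    (Filter.EventuallyEq.refl _ Y).mlieBracket_vectorField_eq (hcongr X Z)]
  exact VectorField.leibniz_identity_mlieBracket_apply (hsmooth X hp) (hsmooth Y hp) (hsmooth Z hp)

theorem dirDeriv_lieBracket_smul (X Y : VectorFields E U) (f : SmoothFun E U)
    (Z : VectorFields E U) : dirDeriv (lieBracket X Y) f • Z =
      (dirDeriv X (dirDeriv Y f) - dirDeriv Y (dirDeriv X f)) • Z := by
  have h := lieBracket_leibniz X Y (f • Z)
  simp only [lieBracket_smul_right, lieBracket_add_right] at h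
  rw [lieBracket_leibniz X Y Z, smul_add, ← sub_eq_zero] at h
  rw [sub_smul, ← sub_eq_zero, ← neg_eq_zero, ← h]
  abel

theorem dirDeriv_lieBracket (X Y : VectorFields E U) (f : SmoothFun E U) :
    dirDeriv (lieBracket X Y) f = dirDeriv X (dirDeriv Y f) - dirDeriv Y (dirDeriv X f) := by
  ext p
  by_cases hZ : ∃ Z : VectorFields E U, Z p ≠ 0
  · obtain ⟨Z, hZ⟩ := hZ
    exact smul_left_injective ℝ hZ congr($(dirDeriv_lieBracket_smul X Y f Z) p)
  · push Not at hZ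
    simp only [SmoothFun.sub_apply, dirDeriv_apply_eq_zero (hZ _), sub_zero]

end LieBracket

/-! ### Tensoriality and nondegenerate forms -/

section Tensoriality

theorem linearMap_apply_of_notMem (α : Module.Dual (SmoothFun E U) (VectorFields E U)) {p : M}
    (hp : p ∉ U) (X : VectorFields E U) : α X p = 0 := by
  classical
  let χ : SmoothFun E U := .mk (fun q => if q ∈ U then 1 else 0) fun q hq =>
    (contMDiffAt_const (c := (1 : ℝ))).congr_of_eventuallyEq (by
      filter_upwards [U.isOpen.mem_nhds hq] with r hr using if_pos hr)
  have hχ : χ • X = X := VectorFields.ext_on fun q hq => by simp [χ, hq]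
  rw [← hχ, map_smul, smul_eq_mul, SmoothFun.mul_apply, SmoothFun.mk_apply, if_neg hp, zero_mul]

theorem exists_vectorFields_of_eventually_eq (W : M → VectorFields E U)
    (hW : ∀ p ∈ U, ∀ᶠ q in 𝓝 p, W q q = W p q) :
    ∃ X : VectorFields E U, ∀ p ∈ U, X p = W p p :=
  ⟨.mk (fun p => W p p) fun p hp => ((W p).contMDiffAt hp).congr_of_eventuallyEq
    ((hW p hp).mono fun _ hq => congrArg (TotalSpace.mk _) hq), fun _ hp =>
    VectorFields.mk_apply _ hp⟩

variable [FiniteDimensional ℝ E]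

theorem exists_eq_sum_smul_of_linearIndependent {p : M} {ι : Type*} [Fintype ι]
    {e : ι → VectorFields E U} (hι : Fintype.card ι = Module.finrank ℝ E)
    (he : LinearIndependent ℝ fun i => e i p) (v : TangentSpace 𝓘(ℝ, E) p) :
    ∃ c : ι → ℝ, (∑ i, algebraMap ℝ (SmoothFun E U) (c i) • e i) p = v := by
  have : FiniteDimensional ℝ (TangentSpace 𝓘(ℝ, E) p) := inferInstanceAs (FiniteDimensional ℝ E)
  have hv : v ∈ Submodule.span ℝ (Set.range fun i => e i p) :=
    he.span_eq_top_of_card_eq_finrank' hι ▸ Submodule.mem_top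
  simpa using (Submodule.mem_span_range_iff_exists_fun ℝ).1 hv

variable [T2Space M]

theorem exists_smoothFun_bump {p : M} {s : Set M} (hs : s ∈ 𝓝 p) :
    ∃ χ : SmoothFun E U, (∀ᶠ q in 𝓝 p, χ q = 1) ∧ ∀ q ∉ s, χ q = 0 := by
  obtain ⟨χ, -, hχ⟩ := (SmoothBumpFunction.nhds_basis_tsupport (I := 𝓘(ℝ, E)) p).mem_iff.1 hs
  exact ⟨.mk χ fun q _ => χ.contMDiffAt, χ.eventuallyEq_one, fun q hq =>
    image_eq_zero_of_notMem_tsupport fun h => hq (hχ h)⟩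

theorem exists_vectorFields_eventuallyEq {p : M} (hp : p ∈ U)
    {s : (q : M) → TangentSpace 𝓘(ℝ, E) q}
    (hs : ∀ᶠ q in 𝓝 p, ContMDiffAt 𝓘(ℝ, E) 𝓘(ℝ, E).tangent ∞
      (fun q => (⟨q, s q⟩ : TangentBundle 𝓘(ℝ, E) M)) q) :
    ∃ X : VectorFields E U, ∀ᶠ q in 𝓝 p, X q = s q := by
  obtain ⟨W, hs, hW, hpW⟩ := eventually_nhds_iff.1 hs
  obtain ⟨χ, -, hχ⟩ := (SmoothBumpFunction.nhds_basis_tsupport (I := 𝓘(ℝ, E)) p).mem_iff.1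
    (hW.mem_nhds hpW)
  have h := ContMDiffOn.smul_section_of_tsupport (s := s) (n := ∞) χ.contMDiff.contMDiffOn hW hχ
    fun q hq => (hs q hq).contMDiffWithinAt
  refine ⟨.mk (fun q => χ q • s q) fun q _ => h.contMDiffAt, ?_⟩
  filter_upwards [χ.eventuallyEq_one, U.isOpen.mem_nhds hp] with q hq hqU
  rw [VectorFields.mk_apply _ hqU, hq]
  exact one_smul ℝ (s q)

theorem exists_smoothFun_eventuallyEq {p : M} {f : M → ℝ}
    (hf : ∀ᶠ q in 𝓝 p, ContMDiffAt 𝓘(ℝ, E) 𝓘(ℝ, ℝ) ∞ f q) :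
    ∃ h : SmoothFun E U, ∀ᶠ q in 𝓝 p, h q = f q := by
  obtain ⟨χ, -, hχ⟩ := (SmoothBumpFunction.nhds_basis_tsupport (I := 𝓘(ℝ, E)) p).mem_iff.1 hf
  have h : ContMDiff 𝓘(ℝ, E) 𝓘(ℝ, ℝ) ∞ (fun q => χ q • f q) :=
    contMDiff_of_tsupport fun q hq =>
      χ.contMDiffAt.smul (hχ (tsupport_smul_subset_left _ _ hq))
  refine ⟨.mk _ fun q _ => h.contMDiffAt, ?_⟩
  filter_upwards [χ.eventuallyEq_one] with q hq
  simp [hq]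

theorem exists_frame {p : M} (hp : p ∈ U) :
    ∃ e : Fin (Module.finrank ℝ E) → VectorFields E U,
      (∀ᶠ q in 𝓝 p, LinearIndependent ℝ fun i => e i q) ∧
      ∀ X : VectorFields E U, ∃ c : Fin (Module.finrank ℝ E) → SmoothFun E U,
        ∀ᶠ q in 𝓝 p, X q = ∑ i, c i q • e i q := by
  let b := Module.finBasis ℝ E
  let t := trivializationAt E (TangentSpace 𝓘(ℝ, E) : M → Type _) p
  have : IsManifold 𝓘(ℝ, E) (∞ + 1) M := by simpa
  have ht : ∀ᶠ q in 𝓝 p, q ∈ t.baseSet :=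
    t.open_baseSet.mem_nhds (mem_baseSet_trivializationAt E _ p)
  choose e he using fun i => exists_vectorFields_eventuallyEq (s := t.localFrame b i) hp
    (ht.mono fun q hq => (t.contMDiffOn_localFrame_baseSet ∞ b i).contMDiffAt
      (t.open_baseSet.mem_nhds hq))
  replace he := Filter.eventually_all.2 he
  refine ⟨e, ?_, fun X => ?_⟩
  · filter_upwards [he, ht] with q hq hqt
    simpa only [hq] using
      (t.isLocalFrameOn_localFrame_baseSet 𝓘(ℝ, E) ∞ b).linearIndependent hqt
  · choose c hc using fun i => exists_smoothFun_eventuallyEq (E := E) (U := U)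
      (f := fun q => t.localFrameCoeff 𝓘(ℝ, E) b i q (X q))
      ((ht.and (U.isOpen.mem_nhds hp)).mono fun q hq =>
        contMDiffAt_localFrameCoeff b hq.1 (X.contMDiffAt hq.2) i)
    refine ⟨c, ?_⟩
    filter_upwards [he, Filter.eventually_all.2 hc, ht] with q hq hcq hqt
    simp only [hq, hcq]
    exact t.eq_sum_localFrameCoeff_smul (I := 𝓘(ℝ, E)) (s := X) hqt

theorem exists_vectorFields_apply_eq {p : M} (hp : p ∈ U) (v : TangentSpace 𝓘(ℝ, E) p) :
    ∃ X : VectorFields E U, X p = v := by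
  obtain ⟨e, he, -⟩ := exists_frame (E := E) hp
  obtain ⟨c, hc⟩ := exists_eq_sum_smul_of_linearIndependent (Fintype.card_fin _) he.self_of_nhds v
  exact ⟨_, hc⟩

theorem linearMap_apply_congr_eventually (α : Module.Dual (SmoothFun E U) (VectorFields E U))
    {p : M} {X Y : VectorFields E U} (h : ∀ᶠ q in 𝓝 p, X q = Y q) : α X p = α Y p := by
  obtain ⟨χ, hχ, hχ0⟩ := exists_smoothFun_bump (E := E) (U := U) h
  have hXY : χ • X = χ • Y := by
    ext q
    by_cases hq : X q = Y q
    · simp [hq]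
    · simp [hχ0 q hq]
  simpa [hχ.self_of_nhds] using congr(α $hXY p)

theorem linearMap_apply_congr (α : Module.Dual (SmoothFun E U) (VectorFields E U)) {p : M}
    (hp : p ∈ U) {X Y : VectorFields E U} (h : X p = Y p) : α X p = α Y p := by
  obtain ⟨e, he, hc⟩ := exists_frame (E := E) hp
  obtain ⟨c, hc⟩ := hc (X - Y)
  have hcp : ∀ i, c i p = 0 := Fintype.linearIndependent_iff.1 he.self_of_nhds (fun i => c i p) (by
    rw [← hc.self_of_nhds, VectorFields.sub_apply, h, sub_self])
  have hα : α (X - Y) p = α (∑ i, c i • e i) p :=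
    linearMap_apply_congr_eventually α (by simpa using hc)
  rw [← sub_eq_zero, ← SmoothFun.sub_apply, ← map_sub, hα]
  simp [hcp]

theorem linearMap_apply_eq_of_linearIndependent
    {α β : Module.Dual (SmoothFun E U) (VectorFields E U)} {p : M} (hp : p ∈ U) {ι : Type*}
    [Fintype ι] {e : ι → VectorFields E U} (hι : Fintype.card ι = Module.finrank ℝ E)
    (he : LinearIndependent ℝ fun i => e i p) (h : ∀ i, α (e i) p = β (e i) p)
    (X : VectorFields E U) : α X p = β X p := by
  obtain ⟨c, hc⟩ := exists_eq_sum_smul_of_linearIndependent hι he (X p)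
  rw [linearMap_apply_congr α hp hc.symm, linearMap_apply_congr β hp hc.symm]
  simp [h]

end Tensoriality

/-- A bilinear form on vector fields is pointwise nondegenerate if the bilinear form that it
induces on each tangent space has trivial kernel. A form that is bilinear over the smooth functions
acts pointwise, so that fields can stand for tangent vectors here. -/
def IsPointwiseNondegenerate (B : LinearMap.BilinForm (SmoothFun E U) (VectorFields E U)) : Prop :=
  ∀ p ∈ U, ∀ X, (∀ Z, B X Z p = 0) → X p = 0

namespace IsPointwiseNondegenerate

variable {B : LinearMap.BilinForm (SmoothFun E U) (VectorFields E U)}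

theorem apply_eq (hB : IsPointwiseNondegenerate B) {p : M} (hp : p ∈ U) {X Y : VectorFields E U}
    (h : ∀ Z, B X Z p = B Y Z p) : X p = Y p :=
  sub_eq_zero.1 (hB p hp (X - Y) fun Z => by simp [h Z])

theorem injective (hB : IsPointwiseNondegenerate B) : Function.Injective B :=
  fun _ _ h => VectorFields.ext_on fun _ hp => hB.apply_eq hp fun _ => by rw [h]

variable [FiniteDimensional ℝ E] [T2Space M]

theorem det_gram_ne_zero (hB : IsPointwiseNondegenerate B) {p : M} (hp : p ∈ U) {ι : Type*}
    [Fintype ι] [DecidableEq ι] {e : ι → VectorFields E U}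
    (hι : Fintype.card ι = Module.finrank ℝ E) (he : LinearIndependent ℝ fun i => e i p) :
    (Matrix.of fun i j => B (e i) (e j)).det p ≠ 0 := by
  intro hdet
  have hG : (Matrix.of fun i j => B (e i) (e j) p).det = 0 := by
    rw [← hdet, ← SmoothFun.eval_apply p (Matrix.det _), AlgHom.map_det]
    rfl
  obtain ⟨a, ha, haG⟩ := Matrix.exists_vecMul_eq_zero_iff.2 hG
  let X : VectorFields E U := ∑ i, algebraMap ℝ (SmoothFun E U) (a i) • e i
  have hX : X p = 0 := hB p hp X <|
    linearMap_apply_eq_of_linearIndependent (α := B X) (β := 0) hp hι he fun j => by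
      simpa [Matrix.vecMul, dotProduct, X] using congrFun haG j
  exact ha (funext (Fintype.linearIndependent_iff.1 he a (by simpa [X] using hX)))

theorem exists_eventually_eq (hB : IsPointwiseNondegenerate B)
    (α : Module.Dual (SmoothFun E U) (VectorFields E U)) {p : M} (hp : p ∈ U) :
    ∃ W : VectorFields E U, ∀ᶠ q in 𝓝 p, ∀ Z, B W Z q = α Z q := by
  obtain ⟨e, he, -⟩ := exists_frame (E := E) hp
  let G : Matrix _ _ (SmoothFun E U) := .of fun i j => B (e i) (e j)
  have hG : ∀ᶠ q in 𝓝 p, q ∈ U ∧ G.det q ≠ 0 := (U.isOpen.eventually_mem hp).and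
    ((G.det.contMDiffAt hp).continuousAt.eventually_ne
      (hB.det_gram_ne_zero hp (Fintype.card_fin _) he.self_of_nhds))
  obtain ⟨h, hh⟩ := exists_smoothFun_eventuallyEq (E := E) (U := U) (f := fun q => (G.det q)⁻¹)
    (hG.mono fun q hq => (G.det.contMDiffAt hq.1).inv₀ hq.2)
  -- Cramer's rule
  let c := Matrix.vecMul (fun j => α (e j)) G.adjugate
  have hc (j) : B (∑ i, c i • e i) (e j) = G.det * α (e j) := by
    have : Matrix.vecMul c G j = G.det * α (e j) := by
      rw [Matrix.vecMul_vecMul, Matrix.adjugate_mul, Matrix.vecMul_smul, Matrix.vecMul_one]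
      rfl
    simpa [Matrix.vecMul, dotProduct, G] using this
  refine ⟨h • ∑ i, c i • e i, ?_⟩
  filter_upwards [he, hG, hh] with q heq hGq hhq
  refine linearMap_apply_eq_of_linearIndependent hGq.1 (Fintype.card_fin _) heq fun j => ?_
  rw [map_smul, LinearMap.smul_apply, hc, smul_eq_mul, SmoothFun.mul_apply, SmoothFun.mul_apply,
    hhq, inv_mul_cancel_left₀ hGq.2]

theorem surjective (hB : IsPointwiseNondegenerate B) : Function.Surjective B := by
  intro α
  choose! W hW using fun p (hp : p ∈ U) => hB.exists_eventually_eq α hp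
  obtain ⟨X, hX⟩ := exists_vectorFields_of_eventually_eq W fun p hp => by
    filter_upwards [hW p hp, U.isOpen.mem_nhds hp] with q hq hqU
    exact hB.apply_eq hqU fun Z => ((hW q hqU).self_of_nhds Z).trans (hq Z).symm
  refine ⟨X, LinearMap.ext fun Z => SmoothFun.ext fun p => ?_⟩
  by_cases hp : p ∈ U
  · exact (linearMap_apply_congr (B.flip Z) hp (hX p hp)).trans ((hW p hp).self_of_nhds Z)
  · rw [linearMap_apply_of_notMem _ hp, linearMap_apply_of_notMem _ hp]

/-- The musical isomorphism from one-forms to vector fields: the inverse of `X ↦ B(X, ·)`. -/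
def sharp (hB : IsPointwiseNondegenerate B) :
    Module.Dual (SmoothFun E U) (VectorFields E U) ≃ₗ[SmoothFun E U] VectorFields E U :=
  (LinearEquiv.ofBijective B ⟨hB.injective, hB.surjective⟩).symm

@[simp] theorem apply_sharp (hB : IsPointwiseNondegenerate B)
    (α : Module.Dual (SmoothFun E U) (VectorFields E U)) : B (hB.sharp α) = α :=
  (LinearEquiv.ofBijective B _).apply_symm_apply α

end IsPointwiseNondegenerate

/-! ### Linear connections and their curvature -/

namespace IsLinearConnection

variable {Γ : Type*} [AddCommGroup Γ] [Module (SmoothFun E U) Γ] {D : VectorFields E U → Γ → Γ}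

theorem neg_left (hD : IsLinearConnection D) (W : VectorFields E U) (s : Γ) :
    D (-W) s = -D W s :=
  map_neg (AddMonoidHom.mk' (D · s) fun W W' => hD.add_left W W' s) W

theorem sub_right (hD : IsLinearConnection D) (W : VectorFields E U) (s t : Γ) :
    D W (s - t) = D W s - D W t :=
  map_sub (AddMonoidHom.mk' (D W) (hD.add_right W)) s t

variable [FiniteDimensional ℝ E]

theorem curvature_swap (hD : IsLinearConnection D) (X Y : VectorFields E U) (s : Γ) :
    curvature D X Y s = -curvature D Y X s := by
  rw [curvature, curvature, lieBracket_swap, hD.neg_left]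
  abel

theorem curvature_sub_right (hD : IsLinearConnection D) (X Y : VectorFields E U) (s t : Γ) :
    curvature D X Y (s - t) = curvature D X Y s - curvature D X Y t := by
  simp only [curvature, hD.sub_right]
  abel

theorem curvature_smul_right (hD : IsLinearConnection D) (X Y : VectorFields E U)
    (f : SmoothFun E U) (s : Γ) : curvature D X Y (f • s) = f • curvature D X Y s := by
  simp only [curvature, hD.leibniz, hD.add_right, dirDeriv_lieBracket, smul_sub, sub_smul]
  abel

theorem curvature_bianchi {D : VectorFields E U → VectorFields E U → VectorFields E U}
    (hD : IsLinearConnection D) (htor : ∀ X Y, D X Y - D Y X = lieBracket X Y)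
    (X Y Z : VectorFields E U) :
    curvature D X Y Z + curvature D Y Z X + curvature D Z X Y = 0 := by
  have hbracket (X Y Z) : lieBracket X (lieBracket Y Z) =
      D X (D Y Z) - D X (D Z Y) - D (lieBracket Y Z) X := by
    rw [← hD.sub_right, htor, htor]
  have hjacobi := lieBracket_leibniz X Y Z
  rw [lieBracket_swap (lieBracket X Y) Z, lieBracket_swap X Z, lieBracket_neg_right, hbracket,
    hbracket, hbracket, ← sub_eq_zero] at hjacobi
  rw [← hjacobi, curvature, curvature, curvature]
  abel

end IsLinearConnection

section Koszul

variable [FiniteDimensional ℝ E] {B : LinearMap.BilinForm (SmoothFun E U) (VectorFields E U)}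

/-- The Koszul one-form of `X` and `Y`: for the Levi-Civita connection `∇` of `B`, its value at `Z`
is `2 B(∇_X Y, Z)`. -/
def koszul (B : LinearMap.BilinForm (SmoothFun E U) (VectorFields E U)) (X Y : VectorFields E U) :
    Module.Dual (SmoothFun E U) (VectorFields E U) where
  toFun Z := dirDeriv X (B Y Z) + dirDeriv Y (B X Z) - dirDeriv Z (B X Y) + B (lieBracket X Y) Z
    - B X (lieBracket Y Z) - B Y (lieBracket X Z)
  map_add' Z W := by
    simp only [map_add, dirDeriv_add, dirDeriv_add_left, lieBracket_add_right]
    ring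
  map_smul' f Z := by
    simp only [map_smul, map_add, smul_eq_mul, dirDeriv_mul, dirDeriv_smul_left,
      lieBracket_smul_right, RingHom.id_apply]
    ring

theorem koszul_apply (X Y Z : VectorFields E U) :
    koszul B X Y Z = dirDeriv X (B Y Z) + dirDeriv Y (B X Z) - dirDeriv Z (B X Y)
      + B (lieBracket X Y) Z - B X (lieBracket Y Z) - B Y (lieBracket X Z) := rfl

variable [T2Space M]

namespace IsPointwiseNondegenerate

/-- The connection `∇` with `B(∇_X Y, Z) = ½ K(X, Y; Z) + T(X, Y, Z)`, where `K` is the Koszul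
form: the Levi-Civita connection of `B` modified by a tensor field `T`. -/
def koszulConnection (hB : IsPointwiseNondegenerate B)
    (T : VectorFields E U →ₗ[SmoothFun E U] LinearMap.BilinForm (SmoothFun E U) (VectorFields E U))
    (X Y : VectorFields E U) : VectorFields E U :=
  hB.sharp ((1 / 2 : ℝ) • koszul B X Y + T X Y)

variable (hB : IsPointwiseNondegenerate B)
  {T : VectorFields E U →ₗ[SmoothFun E U] LinearMap.BilinForm (SmoothFun E U) (VectorFields E U)}

theorem koszulConnection_apply (X Y Z : VectorFields E U) :
    B (hB.koszulConnection T X Y) Z = (1 / 2 : ℝ) • koszul B X Y Z + T X Y Z := by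
  rw [koszulConnection, apply_sharp]
  rfl

theorem isLinearConnection_koszulConnection (hsymm : B.IsSymm) :
    IsLinearConnection (hB.koszulConnection T) := by
  refine ⟨fun W W' Y => hB.injective ?_, fun f X Y => hB.injective ?_,
    fun W Y Y' => hB.injective ?_, fun W f Y => hB.injective ?_⟩ <;> ext Z p
  · simp only [map_add, LinearMap.add_apply, koszulConnection_apply, koszul_apply, dirDeriv_add,
      dirDeriv_add_left, lieBracket_add_left, SmoothFun.add_apply, SmoothFun.sub_apply,
      SmoothFun.smul_apply]
    ring
  · simp only [map_smul, map_add, LinearMap.add_apply, LinearMap.smul_apply, koszulConnection_apply,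
      koszul_apply, smul_eq_mul, dirDeriv_mul, dirDeriv_smul_left, lieBracket_smul_left,
      hsymm.eq Y X, SmoothFun.add_apply, SmoothFun.sub_apply, SmoothFun.smul_apply,
      SmoothFun.mul_apply, SmoothFun.neg_apply]
    ring
  · simp only [map_add, LinearMap.add_apply, koszulConnection_apply, koszul_apply, dirDeriv_add,
      dirDeriv_add_left, lieBracket_add_left, lieBracket_add_right, SmoothFun.add_apply,
      SmoothFun.sub_apply, SmoothFun.smul_apply]
    ring
  · simp only [map_smul, map_add, LinearMap.add_apply, LinearMap.smul_apply, koszulConnection_apply,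
      koszul_apply, smul_eq_mul, dirDeriv_mul, dirDeriv_smul_left, lieBracket_smul_left,
      lieBracket_smul_right, SmoothFun.add_apply, SmoothFun.sub_apply, SmoothFun.smul_apply,
      SmoothFun.mul_apply, SmoothFun.neg_apply]
    ring

theorem koszulConnection_torsionFree (hsymm : B.IsSymm) (hT : ∀ X Y, T X Y = T Y X)
    (X Y : VectorFields E U) :
    hB.koszulConnection T X Y - hB.koszulConnection T Y X = lieBracket X Y := by
  apply hB.injective
  ext Z p
  simp only [map_sub, LinearMap.sub_apply, koszulConnection_apply, koszul_apply, hT Y X,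
    hsymm.eq Y X, lieBracket_swap Y X, map_neg, LinearMap.neg_apply, SmoothFun.add_apply,
    SmoothFun.sub_apply, SmoothFun.smul_apply, SmoothFun.neg_apply]
  ring

theorem dirDeriv_eq_koszulConnection (hsymm : B.IsSymm) (X Y Z : VectorFields E U) :
    dirDeriv X (B Y Z) = B (hB.koszulConnection T X Y) Z + B Y (hB.koszulConnection T X Z)
      - (T X Y Z + T X Z Y) := by
  ext p
  rw [hsymm.eq Y (hB.koszulConnection T X Z)]
  simp only [koszulConnection_apply, koszul_apply, hsymm.eq Z Y, lieBracket_swap Z Y, map_neg,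
    hsymm.eq (lieBracket X Y) Z, hsymm.eq (lieBracket X Z) Y, SmoothFun.add_apply,
    SmoothFun.sub_apply, SmoothFun.smul_apply, SmoothFun.neg_apply]
  ring

end IsPointwiseNondegenerate

end Koszul

/-- `D` is the Levi-Civita connection of the symmetric bilinear form `B` on vector fields: it is
linear, torsion-free and metric. -/
structure IsLeviCivita [FiniteDimensional ℝ E]
    (B : LinearMap.BilinForm (SmoothFun E U) (VectorFields E U))
    (D : VectorFields E U → VectorFields E U → VectorFields E U) : Prop where
  isSymm : B.IsSymm
  linear : IsLinearConnection D
  torsion_free : ∀ X Y, D X Y - D Y X = lieBracket X Y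
  metric : ∀ X Y Z, dirDeriv X (B Y Z) = B (D X Y) Z + B Y (D X Z)

namespace IsLeviCivita

variable [FiniteDimensional ℝ E] {B : LinearMap.BilinForm (SmoothFun E U) (VectorFields E U)}
  {D : VectorFields E U → VectorFields E U → VectorFields E U}

theorem curvature_metric_swap (hD : IsLeviCivita B D) (X Y Z W : VectorFields E U) :
    B (curvature D X Y Z) W = -B (curvature D X Y W) Z := by
  have h := dirDeriv_lieBracket X Y (B Z W)
  simp only [hD.metric, dirDeriv_add] at h
  rw [hD.isSymm.eq _ Z]
  simp only [curvature, map_sub, LinearMap.sub_apply]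
  linear_combination -h

theorem curvature_pair_symm (hD : IsLeviCivita B D) (X Y Z W : VectorFields E U) :
    B (curvature D X Y Z) W = B (curvature D Z W X) Y := by
  ext p
  have hbianchi (X Y Z W) : B (curvature D X Y Z) W p + B (curvature D Y Z X) W p +
      B (curvature D Z X Y) W p = 0 := by
    simpa using congr(B $(hD.linear.curvature_bianchi hD.torsion_free X Y Z) W p)
  have hswap (X Y Z W) : B (curvature D X Y Z) W p = -B (curvature D Y X Z) W p := by
    simpa using congr(B $(hD.linear.curvature_swap X Y Z) W p)
  have hmetric (X Y Z W) : B (curvature D X Y Z) W p = -B (curvature D X Y W) Z p :=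
    congr($(hD.curvature_metric_swap X Y Z W) p)
  linarith [hbianchi Z X Y W, hbianchi X Y W Z, hbianchi Y W Z X, hbianchi W Z X Y,
    hmetric X Y Z W, hmetric Y W X Z, hmetric Z X Y W, hmetric Z Y X W, hmetric X W Y Z,
    hmetric W Z X Y, hswap Y Z X W, hswap W X Y Z, hswap Z W X Y]

end IsLeviCivita

namespace IsLinearConnection

variable {Γ : Type*} [AddCommGroup Γ] [Module (SmoothFun E U) Γ] {D : VectorFields E U → Γ → Γ}
  {P : Submodule (SmoothFun E U) Γ}

/-- The connection induced on a submodule of sections that is preserved by `D`. -/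
def restrict (hP : ∀ W, ∀ s ∈ P, D W s ∈ P) (W : VectorFields E U) (s : P) : P :=
  ⟨D W s, hP W s s.2⟩

theorem isLinearConnection_restrict (hD : IsLinearConnection D) (hP : ∀ W, ∀ s ∈ P, D W s ∈ P) :
    IsLinearConnection (restrict hP) where
  add_left W W' s := Subtype.ext (hD.add_left W W' s)
  smul_left f W s := Subtype.ext (hD.smul_left f W s)
  add_right W s s' := Subtype.ext (hD.add_right W s s')
  leibniz W f s := Subtype.ext (hD.leibniz W f s)

/-- The connection induced on the quotient by a submodule of sections that is preserved by `D`. -/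
def quotient (hD : IsLinearConnection D) (hP : ∀ W, ∀ s ∈ P, D W s ∈ P) (W : VectorFields E U) :
    Γ ⧸ P → Γ ⧸ P :=
  Quotient.map (D W) fun s t h => P.quotientRel_def.2 <| by
    rw [← hD.sub_right]
    exact hP W _ (P.quotientRel_def.1 h)

theorem quotient_mk (hD : IsLinearConnection D) (hP : ∀ W, ∀ s ∈ P, D W s ∈ P)
    (W : VectorFields E U) (s : Γ) :
    hD.quotient hP W (Submodule.Quotient.mk s) = Submodule.Quotient.mk (D W s) := rfl

theorem isLinearConnection_quotient (hD : IsLinearConnection D)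
    (hP : ∀ W, ∀ s ∈ P, D W s ∈ P) : IsLinearConnection (hD.quotient hP) where
  add_left W W' := (Submodule.Quotient.mk_surjective P).forall.2 fun s =>
    congrArg Submodule.Quotient.mk (hD.add_left W W' s)
  smul_left f W := (Submodule.Quotient.mk_surjective P).forall.2 fun s =>
    congrArg Submodule.Quotient.mk (hD.smul_left f W s)
  add_right W := (Submodule.Quotient.mk_surjective P).forall₂.2 fun s t =>
    congrArg Submodule.Quotient.mk (hD.add_right W s t)
  leibniz W f := (Submodule.Quotient.mk_surjective P).forall.2 fun s =>
    congrArg Submodule.Quotient.mk (hD.leibniz W f s)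

theorem isFlat_quotient_iff [FiniteDimensional ℝ E] (hD : IsLinearConnection D)
    (hP : ∀ W, ∀ s ∈ P, D W s ∈ P) :
    IsFlat (hD.quotient hP) ↔ ∀ X Y s, curvature D X Y s ∈ P :=
  forall₂_congr fun _ _ => (Submodule.Quotient.mk_surjective P).forall.trans <|
    forall_congr' fun _ => Submodule.Quotient.mk_eq_zero P

theorem mem_span_singleton_of_parallel (hD : IsLinearConnection D) {n s : Γ}
    (hpar : ∀ W, D W n = 0) (hs : s ∈ Submodule.span (SmoothFun E U) {n}) (W : VectorFields E U) :
    D W s ∈ Submodule.span (SmoothFun E U) {n} := by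
  obtain ⟨f, rfl⟩ := Submodule.mem_span_singleton.1 hs
  rw [hD.leibniz, hpar, smul_zero, zero_add]
  exact Submodule.smul_mem _ _ (Submodule.mem_span_singleton_self n)

end IsLinearConnection

/-! ### The orthogonal complement of a nowhere vanishing field -/

theorem mem_span_singleton_of_smul_eq_smul {N Y : VectorFields E U} (hN : ∀ p ∈ U, N p ≠ 0)
    (h : ∀ p ∈ U, ∃ a b : SmoothFun E U, a p ≠ 0 ∧ a • Y = b • N) :
    Y ∈ Submodule.span (SmoothFun E U) {N} := by
  choose! a b ha hab using h
  have hY {p q : M} (hp : p ∈ U) (hq : a p q ≠ 0) : Y q = (b p q / a p q) • N q := by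
    have h : a p q • Y q = b p q • N q := congr($(hab p hp) q)
    rw [div_eq_inv_mul, mul_smul, ← h, inv_smul_smul₀ hq]
  refine Submodule.mem_span_singleton.2 ⟨.mk (fun q => b q q / a q q) fun p hp => ?_,
    VectorFields.ext_on fun q hq => (hY hq (ha q hq)).symm⟩
  refine (((b p).contMDiffAt hp).div₀ ((a p).contMDiffAt hp) (ha p hp)).congr_of_eventuallyEq ?_
  filter_upwards [((a p).contMDiffAt hp).continuousAt.eventually_ne (ha p hp),
    U.isOpen.mem_nhds hp] with q hq hqU
  exact smul_left_injective ℝ (hN q hqU) ((hY hqU (ha q hqU)).symm.trans (hY hp hq))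

section Orthogonal

variable {B : LinearMap.BilinForm (SmoothFun E U) (VectorFields E U)} {N : VectorFields E U}

theorem apply_smul_sub_smul_eq_zero (X Y : VectorFields E U) :
    B N (B N Y • X - B N X • Y) = 0 := by
  rw [map_sub, map_smul, map_smul, smul_eq_mul, smul_eq_mul, mul_comm, sub_self]

theorem IsPointwiseNondegenerate.exists_apply_ne_zero (hB : IsPointwiseNondegenerate B) {p : M}
    (hp : p ∈ U) (hN : N p ≠ 0) : ∃ V, B N V p ≠ 0 := by
  contrapose! hN
  exact hB p hp N hN

theorem IsPointwiseNondegenerate.mem_span_singleton_of_forall (hB : IsPointwiseNondegenerate B)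
    (hN : ∀ p ∈ U, N p ≠ 0) {Y : VectorFields E U} (hY : ∀ W, B N W = 0 → B Y W = 0) :
    Y ∈ Submodule.span (SmoothFun E U) {N} := by
  refine mem_span_singleton_of_smul_eq_smul hN fun p hp => ?_
  obtain ⟨V, hV⟩ := hB.exists_apply_ne_zero hp (hN p hp)
  refine ⟨B N V, B Y V, hV, hB.injective (LinearMap.ext fun W => ?_)⟩
  have h := hY _ (apply_smul_sub_smul_eq_zero W V)
  simp only [map_sub, map_smul, LinearMap.smul_apply, smul_eq_mul] at h ⊢
  linear_combination h

namespace IsLeviCivita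

variable [FiniteDimensional ℝ E] {D : VectorFields E U → VectorFields E U → VectorFields E U}

theorem apply_apply_eq_zero_of_parallel (hD : IsLeviCivita B D) (hpar : ∀ W, D W N = 0)
    {Y : VectorFields E U} (hY : B N Y = 0) (W : VectorFields E U) : B N (D W Y) = 0 := by
  have h := hD.metric W N Y
  rwa [hY, hpar, map_zero, LinearMap.zero_apply, zero_add, dirDeriv_zero, eq_comm] at h

theorem curvature_eq_zero_of_forall_orthogonal (hD : IsLeviCivita B D)
    (hB : IsPointwiseNondegenerate B)
    (hN : ∀ p ∈ U, N p ≠ 0) {Z W : VectorFields E U}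
    (h : ∀ X, B N X = 0 → curvature D Z W X = 0) (X : VectorFields E U) :
    curvature D Z W X = 0 := by
  -- a skew-symmetric operator that vanishes on a hyperplane vanishes
  refine VectorFields.ext_on fun p hp => hB.apply_eq hp fun Y => ?_
  obtain ⟨V, hV⟩ := hB.exists_apply_ne_zero hp (hN p hp)
  have hR (X Y) :
      B N V p * B (curvature D Z W X) Y p = B N X p * B (curvature D Z W V) Y p := by
    have h := h _ (apply_smul_sub_smul_eq_zero X V)
    rw [hD.linear.curvature_sub_right, hD.linear.curvature_smul_right,
      hD.linear.curvature_smul_right, sub_eq_zero] at h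
    simpa using congr(B $h Y p)
  have hskew (X Y) : B (curvature D Z W X) Y p = -B (curvature D Z W Y) X p :=
    congr($(hD.curvature_metric_swap Z W X Y) p)
  have hVV : B (curvature D Z W V) V p = 0 := by linarith [hskew V V]
  have hVY : B N V p * B (curvature D Z W V) Y p = 0 := by
    rw [hskew V Y, mul_neg, hR, hVV, mul_zero, neg_zero]
  have hXY := hR X Y
  rw [(mul_eq_zero.1 hVY).resolve_left hV, mul_zero] at hXY
  rw [(mul_eq_zero.1 hXY).resolve_left hV, map_zero]
  rfl

theorem curvature_mem_span_singleton_iff (hD : IsLeviCivita B D) (hB : IsPointwiseNondegenerate B)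
    (hN : ∀ p ∈ U, N p ≠ 0) :
    (∀ X Y Z, B N Z = 0 → curvature D X Y Z ∈ Submodule.span (SmoothFun E U) {N}) ↔
      ∀ X, B N X = 0 → ∀ Y, B N Y = 0 → ∀ Z, B N Z = 0 → curvature D X Y Z = 0 := by
  refine ⟨fun h X hX Y hY Z _ => ?_, fun h X Y Z hZ => ?_⟩
  · refine hB.injective (LinearMap.ext fun W => ?_)
    obtain ⟨c, hc⟩ := Submodule.mem_span_singleton.1 (h Z W X hX)
    rw [hD.curvature_pair_symm, ← hc, map_smul, LinearMap.smul_apply, hY, smul_zero, map_zero]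
    rfl
  · refine hB.mem_span_singleton_of_forall hN fun W hW => ?_
    have hZW := hD.curvature_eq_zero_of_forall_orthogonal hB hN (h Z hZ W hW)
    rw [hD.curvature_pair_symm, hZW, map_zero]
    rfl

end IsLeviCivita

end Orthogonal

/-! ### Vertical derivatives on the tangent bundle -/

section Calculus

variable {F G H : Type*} [NormedAddCommGroup F] [NormedSpace ℝ F] [NormedAddCommGroup G]
  [NormedSpace ℝ G] [NormedAddCommGroup H] [NormedSpace ℝ H]

theorem fderiv_equiv_comp_equiv (f : F → G) (e : E ≃L[ℝ] F) (Φ : G ≃L[ℝ] H) :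
    fderiv ℝ (fun z => Φ (f (e z))) = fun z => e.symm.arrowCongr Φ (fderiv ℝ f (e z)) := by
  ext z u
  have h : fderiv ℝ (Φ ∘ (f ∘ e)) z u = Φ (fderiv ℝ f (e z) (e u)) := by
    rw [Φ.comp_fderiv, e.comp_right_fderiv]
    rfl
  exact h

theorem fderiv_fderiv_equiv_comp_equiv_apply (f : F → G) (e : E ≃L[ℝ] F) (Φ : G ≃L[ℝ] H)
    (y u w : E) :
    fderiv ℝ (fderiv ℝ fun z => Φ (f (e z))) y u w =
      Φ (fderiv ℝ (fderiv ℝ f) (e y) (e u) (e w)) := by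
  rw [fderiv_equiv_comp_equiv, fderiv_equiv_comp_equiv]
  simp

theorem fderiv_fderiv_fderiv_equiv_comp_equiv_apply (f : F → G) (e : E ≃L[ℝ] F) (Φ : G ≃L[ℝ] H)
    (y u w z : E) :
    fderiv ℝ (fderiv ℝ (fderiv ℝ fun z => Φ (f (e z)))) y u w z =
      Φ (fderiv ℝ (fderiv ℝ (fderiv ℝ f)) (e y) (e u) (e w) (e z)) := by
  rw [fderiv_equiv_comp_equiv, fderiv_fderiv_equiv_comp_equiv_apply]
  simp

theorem fderiv_apply_self_of_homogeneous {f : E → F} {y : E} {n : ℕ} (hf : DifferentiableAt ℝ f y)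
    (hom : ∀ c : ℝ, 0 < c → f (c • y) = c ^ n • f y) : fderiv ℝ f y y = (n : ℝ) • f y := by
  have hf' : HasFDerivAt f (fderiv ℝ f y) ((1 : ℝ) • y) := by simpa using hf.hasFDerivAt
  have hcomp : HasDerivAt (fun c : ℝ => f (c • y)) (fderiv ℝ f y y) 1 := by
    simpa [Function.comp_def] using
      hf'.comp_hasDerivAt 1 ((hasDerivAt_id (1 : ℝ)).smul_const y)
  have hpow : HasDerivAt (fun c : ℝ => c ^ n • f y) ((n : ℝ) • f y) 1 := by
    simpa using (hasDerivAt_pow n (1 : ℝ)).smul_const (f y)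
  refine hcomp.unique (hpow.congr_of_eventuallyEq ?_)
  filter_upwards [lt_mem_nhds (zero_lt_one (α := ℝ))] with c hc using hom c hc

theorem eventually_fderiv_homogeneous {f : E → F} {y : E} {n : ℕ}
    (hom : ∀ᶠ z in 𝓝 y, ∀ c : ℝ, 0 < c → f (c • z) = c ^ (n + 1) • f z) :
    ∀ᶠ z in 𝓝 y, ∀ c : ℝ, 0 < c → fderiv ℝ f (c • z) = c ^ n • fderiv ℝ f z := by
  filter_upwards [hom.eventually_nhds] with z hz c hc
  have hcz : (fun w => f (c • w)) =ᶠ[𝓝 z] c ^ (n + 1) • f := hz.mono fun w hw => hw c hc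
  have h := hcz.fderiv_eq (𝕜 := ℝ)
  rw [fderiv_comp_smul, fderiv_const_smul_field, pow_succ', mul_smul] at h
  exact smul_right_injective _ hc.ne' h

theorem fderiv_fderiv_apply_self_of_homogeneous {f : E → F} {y : E} (hf : ContDiffAt ℝ 2 f y)
    (hom : ∀ᶠ z in 𝓝 y, ∀ c : ℝ, 0 < c → f (c • z) = c ^ 2 • f z) :
    fderiv ℝ (fderiv ℝ f) y y y = (2 : ℝ) • f y := by
  have euler₁ := fderiv_apply_self_of_homogeneous (hf.differentiableAt (by simp)) hom.self_of_nhds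
  have euler₂ := fderiv_apply_self_of_homogeneous
    ((hf.fderiv_right (m := 1) (by norm_num)).differentiableAt (by simp))
    (eventually_fderiv_homogeneous hom).self_of_nhds
  rw [euler₂, Nat.cast_one, one_smul, euler₁, Nat.cast_two]

set_option maxSynthPendingDepth 3 in
theorem fderiv_fderiv_fderiv_apply_self_of_homogeneous {f : E → F} {y : E}
    (hf : ContDiffAt ℝ 3 f y)
    (hom : ∀ᶠ z in 𝓝 y, ∀ c : ℝ, 0 < c → f (c • z) = c ^ 2 • f z) :
    fderiv ℝ (fderiv ℝ (fderiv ℝ f)) y y = 0 := by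
  have hf' := (hf.fderiv_right (m := 2) (by norm_num)).fderiv_right (m := 1) (by norm_num)
  rw [fderiv_apply_self_of_homogeneous (n := 0) (hf'.differentiableAt (by simp))
    (eventually_fderiv_homogeneous (eventually_fderiv_homogeneous hom)).self_of_nhds,
    Nat.cast_zero, zero_smul]

theorem fderiv_fderiv_fderiv_swap_left {f : E → ℝ} {y : E} (hf : ContDiffAt ℝ 3 f y) (a b c : E) :
    fderiv ℝ (fderiv ℝ (fderiv ℝ f)) y a b c = fderiv ℝ (fderiv ℝ (fderiv ℝ f)) y b a c := by
  have h : ContDiffAt ℝ 2 (fderiv ℝ f) y := hf.fderiv_right le_rfl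
  rw [(h.isSymmSndFDerivAt (by simp)).eq]

theorem fderiv_fderiv_fderiv_swap_right {f : E → ℝ} {y : E} (hf : ContDiffAt ℝ 3 f y)
    (a b c : E) :
    fderiv ℝ (fderiv ℝ (fderiv ℝ f)) y a b c = fderiv ℝ (fderiv ℝ (fderiv ℝ f)) y a c b := by
  have hd : DifferentiableAt ℝ (fderiv ℝ (fderiv ℝ f)) y :=
    ((hf.fderiv_right (m := 2) le_rfl).fderiv_right (m := 1) le_rfl).differentiableAt one_ne_zero
  have hsymm : (fun z => fderiv ℝ (fderiv ℝ f) z b c) =ᶠ[𝓝 y]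
      fun z => fderiv ℝ (fderiv ℝ f) z c b := by
    filter_upwards [(hf.of_le (m := 2) (by norm_num)).eventually (by simp)] with z hz
    exact (hz.isSymmSndFDerivAt (by simp)).eq b c
  have happly (u w : E) : fderiv ℝ (fun z => fderiv ℝ (fderiv ℝ f) z u w) y a =
      fderiv ℝ (fderiv ℝ (fderiv ℝ f)) y a u w := by
    rw [fderiv_clm_apply (hd.clm_apply (differentiableAt_const u)) (differentiableAt_const w),
      fderiv_clm_apply hd (differentiableAt_const u)]
    simp
  rw [← happly, ← happly, hsymm.fderiv_eq]

theorem contDiffAt_fderiv_snd {f : E → F → G} {x : E × F}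
    (hf : ContDiffAt ℝ ∞ (fun x : E × F => f x.1 x.2) x) :
    ContDiffAt ℝ ∞ (fun x : E × F => fderiv ℝ (f x.1) x.2) x :=
  ContDiffAt.fderiv (n := ∞) (f := fun x : E × F => f x.1)
    (hf.comp (f := fun w : (E × F) × F => (w.1.1, w.2)) (x, x.2) (by fun_prop)) contDiffAt_snd
    (by simp)

end Calculus

section Coordinates

/-- The function `L` on the tangent bundle, in the bundle coordinates around `p₀`. -/
def localRep (L : TangentBundle 𝓘(ℝ, E) M → ℝ) (p₀ : M) (x z : E) : ℝ :=
  L ((trivializationAt E (TangentSpace 𝓘(ℝ, E) : M → Type _) p₀).toOpenPartialHomeomorph.symm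
    ((extChartAt 𝓘(ℝ, E) p₀).symm x, z))

/-- The fibre coordinates around `p₀` of the tangent vectors at `q`. The model space `E` stands for
`T_q M`, since its norm is needed to differentiate along the fibre. -/
def fibreCoord {p₀ q : M} (hq : q ∈ (chartAt E p₀).source) : E ≃L[ℝ] E :=
  (trivializationAt E (TangentSpace 𝓘(ℝ, E) : M → Type _) p₀).continuousLinearEquivAt ℝ q hq

variable {L : TangentBundle 𝓘(ℝ, E) M → ℝ}

theorem apply_eq_localRep {p₀ q : M} (hq : q ∈ (chartAt E p₀).source) (y : TangentSpace 𝓘(ℝ, E) q) :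
    L ⟨q, y⟩ = localRep L p₀ (extChartAt 𝓘(ℝ, E) p₀ q) (fibreCoord hq y) := by
  let t := trivializationAt E (TangentSpace 𝓘(ℝ, E) : M → Type _) p₀
  have hv : (⟨q, y⟩ : TangentBundle 𝓘(ℝ, E) M) ∈ t.source := t.mem_source.2 hq
  have ht : t ⟨q, y⟩ = (q, fibreCoord hq y) := Prod.ext (t.coe_fst hv) rfl
  rw [localRep, (extChartAt 𝓘(ℝ, E) p₀).left_inv (by rwa [extChartAt_source]), ← ht]
  exact congrArg L (t.toOpenPartialHomeomorph.left_inv hv).symm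

theorem fundamentalTensor_eq_localRep {p₀ q : M} (hq : q ∈ (chartAt E p₀).source)
    (y u w : TangentSpace 𝓘(ℝ, E) q) :
    fundamentalTensor L ⟨q, y⟩ u w = 1 / 2 *
      fderiv ℝ (fderiv ℝ (localRep L p₀ (extChartAt 𝓘(ℝ, E) p₀ q))) (fibreCoord hq y)
        (fibreCoord hq u) (fibreCoord hq w) := by
  have h : (fun y : E => L ⟨q, y⟩) = _ := funext (apply_eq_localRep hq)
  exact congrArg ((1 / 2 : ℝ) * ·)
    (h ▸ fderiv_fderiv_equiv_comp_equiv_apply (localRep L p₀ _) (fibreCoord hq) (.refl ℝ ℝ) y u w)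

theorem cartanTensor_eq_localRep {p₀ q : M} (hq : q ∈ (chartAt E p₀).source)
    (y a b c : TangentSpace 𝓘(ℝ, E) q) :
    cartanTensor L ⟨q, y⟩ a b c = 1 / 4 *
      fderiv ℝ (fderiv ℝ (fderiv ℝ (localRep L p₀ (extChartAt 𝓘(ℝ, E) p₀ q)))) (fibreCoord hq y)
        (fibreCoord hq a) (fibreCoord hq b) (fibreCoord hq c) := by
  have h : (fun y : E => L ⟨q, y⟩) = _ := funext (apply_eq_localRep hq)
  exact congrArg ((1 / 4 : ℝ) * ·)
    (h ▸ fderiv_fderiv_fderiv_equiv_comp_equiv_apply (localRep L p₀ _) (fibreCoord hq)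
      (.refl ℝ ℝ) y a b c)

variable {v : TangentBundle 𝓘(ℝ, E) M}

theorem contDiffAt_localRep (hL : ContMDiffAt 𝓘(ℝ, E).tangent 𝓘(ℝ, ℝ) ∞ L v) :
    ContDiffAt ℝ ∞ (fun x : E × E => localRep L v.1 x.1 x.2)
      (extChartAt 𝓘(ℝ, E) v.1 v.1, fibreCoord (mem_chart_source E v.1) v.2) := by
  have h := (contMDiffAt_iff.1 hL).2
  have hr : range 𝓘(ℝ, E).tangent = univ := ModelWithCorners.range_eq_univ _
  rw [hr, contDiffWithinAt_univ, FiberBundle.extChartAt] at h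
  let t := trivializationAt E (TangentSpace 𝓘(ℝ, E) : M → Type _) v.1
  have ht : t v = (v.1, fibreCoord (mem_chart_source E v.1) v.2) :=
    Prod.ext (t.coe_fst FiberBundle.mem_trivializationAt_proj_source) rfl
  have hv : (t.toPartialEquiv ≫ (extChartAt 𝓘(ℝ, E) v.1).prod (PartialEquiv.refl E)) v =
      (extChartAt 𝓘(ℝ, E) v.1 v.1, fibreCoord (mem_chart_source E v.1) v.2) :=
    congrArg ((extChartAt 𝓘(ℝ, E) v.1).prod (PartialEquiv.refl E)) ht
  rwa [hv] at h

theorem contDiffAt_fibre (hL : ContMDiffAt 𝓘(ℝ, E).tangent 𝓘(ℝ, ℝ) ∞ L v) :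
    ContDiffAt ℝ ∞ (fun y : E => L ⟨v.1, y⟩) v.2 := by
  have hv := mem_chart_source E v.1
  have h : (fun y : E => L ⟨v.1, y⟩) = _ := funext (apply_eq_localRep hv)
  exact h ▸ (contDiffAt_localRep hL).comp (f := fun y => (extChartAt 𝓘(ℝ, E) v.1 v.1,
    fibreCoord hv y)) v.2 (contDiffAt_const.prodMk (fibreCoord hv).contDiff.contDiffAt)

end Coordinates

/-! ### The fundamental tensor and the Cartan tensor -/

section AlongMaps

variable {E' : Type*} [NormedAddCommGroup E'] [NormedSpace ℝ E'] {H' : Type*} [TopologicalSpace H']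
  {I : ModelWithCorners ℝ E' H'} {P : Type*} [TopologicalSpace P] [ChartedSpace H' P]
  {L : TangentBundle 𝓘(ℝ, E) M → ℝ} {V : P → TangentBundle 𝓘(ℝ, E) M}
  {X Y Z : (x : P) → TangentSpace 𝓘(ℝ, E) (V x).1} {x₀ : P}

/-- Applied to the vertical derivatives of `L` in coordinates, such as `T x z = D²L(x, ·)(z)`. -/
theorem contMDiffAt_comp_coord {F : Type*} [NormedAddCommGroup F] [NormedSpace ℝ F] {T : E → E → F}
    (hV : ContMDiffAt I 𝓘(ℝ, E).tangent ∞ V x₀)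
    (hT : ContDiffAt ℝ ∞ (fun x : E × E => T x.1 x.2)
      (extChartAt 𝓘(ℝ, E) (V x₀).1 (V x₀).1, fibreCoord (mem_chart_source E (V x₀).1) (V x₀).2)) :
    ContMDiffAt I 𝓘(ℝ, F) ∞ (fun x => T (extChartAt 𝓘(ℝ, E) (V x₀).1 (V x).1)
      (trivializationAt E (TangentSpace 𝓘(ℝ, E)) (V x₀).1 (V x)).2) x₀ := by
  obtain ⟨hbase, hfib⟩ := (contMDiffAt_totalSpace (IB := 𝓘(ℝ, E))).1 hV
  exact hT.contMDiffAt.comp (I' := 𝓘(ℝ, E × E)) x₀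
    ((contMDiffAt_extChartAt.comp x₀ hbase).prodMk_space hfib)

theorem eventually_mem_chart_source (hV : ContMDiffAt I 𝓘(ℝ, E).tangent ∞ V x₀) :
    ∀ᶠ x in 𝓝 x₀, (V x).1 ∈ (chartAt E (V x₀).1).source :=
  ((contMDiffAt_totalSpace (IB := 𝓘(ℝ, E))).1 hV).1.continuousAt.eventually
    ((chartAt E (V x₀).1).open_source.mem_nhds (mem_chart_source E _))

theorem contMDiffAt_fundamentalTensor (hL : ContMDiffAt 𝓘(ℝ, E).tangent 𝓘(ℝ, ℝ) ∞ L (V x₀))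
    (hV : ContMDiffAt I 𝓘(ℝ, E).tangent ∞ V x₀)
    (hX : ContMDiffAt I 𝓘(ℝ, E).tangent ∞
      (fun x => ⟨(V x).1, X x⟩ : P → TangentBundle 𝓘(ℝ, E) M) x₀)
    (hY : ContMDiffAt I 𝓘(ℝ, E).tangent ∞
      (fun x => ⟨(V x).1, Y x⟩ : P → TangentBundle 𝓘(ℝ, E) M) x₀) :
    ContMDiffAt I 𝓘(ℝ, ℝ) ∞ (fun x => fundamentalTensor L (V x) (X x) (Y x)) x₀ := by
  have h := contMDiffAt_comp_coord (T := fun x => fderiv ℝ (fderiv ℝ (localRep L (V x₀).1 x))) hV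
    (contDiffAt_fderiv_snd (f := fun x => fderiv ℝ (localRep L (V x₀).1 x))
      (contDiffAt_fderiv_snd (contDiffAt_localRep hL)))
  refine (contMDiffAt_const (c := (1 / 2 : ℝ)).mul ((h.clm_apply
    ((contMDiffAt_totalSpace (IB := 𝓘(ℝ, E))).1 hX).2).clm_apply
    ((contMDiffAt_totalSpace (IB := 𝓘(ℝ, E))).1 hY).2)).congr_of_eventuallyEq ?_
  filter_upwards [eventually_mem_chart_source hV] with x hx
  exact fundamentalTensor_eq_localRep hx _ _ _

set_option maxSynthPendingDepth 3 in
theorem contMDiffAt_cartanTensor (hL : ContMDiffAt 𝓘(ℝ, E).tangent 𝓘(ℝ, ℝ) ∞ L (V x₀))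
    (hV : ContMDiffAt I 𝓘(ℝ, E).tangent ∞ V x₀)
    (hX : ContMDiffAt I 𝓘(ℝ, E).tangent ∞
      (fun x => ⟨(V x).1, X x⟩ : P → TangentBundle 𝓘(ℝ, E) M) x₀)
    (hY : ContMDiffAt I 𝓘(ℝ, E).tangent ∞
      (fun x => ⟨(V x).1, Y x⟩ : P → TangentBundle 𝓘(ℝ, E) M) x₀)
    (hZ : ContMDiffAt I 𝓘(ℝ, E).tangent ∞
      (fun x => ⟨(V x).1, Z x⟩ : P → TangentBundle 𝓘(ℝ, E) M) x₀) :
    ContMDiffAt I 𝓘(ℝ, ℝ) ∞ (fun x => cartanTensor L (V x) (X x) (Y x) (Z x)) x₀ := by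
  have h := contMDiffAt_comp_coord
    (T := fun x => fderiv ℝ (fderiv ℝ (fderiv ℝ (localRep L (V x₀).1 x)))) hV
    (contDiffAt_fderiv_snd (f := fun x => fderiv ℝ (fderiv ℝ (localRep L (V x₀).1 x)))
      (contDiffAt_fderiv_snd (f := fun x => fderiv ℝ (localRep L (V x₀).1 x))
        (contDiffAt_fderiv_snd (contDiffAt_localRep hL))))
  refine (contMDiffAt_const (c := (1 / 4 : ℝ)).mul (((h.clm_apply
    ((contMDiffAt_totalSpace (IB := 𝓘(ℝ, E))).1 hX).2).clm_apply
    ((contMDiffAt_totalSpace (IB := 𝓘(ℝ, E))).1 hY).2).clm_apply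
    ((contMDiffAt_totalSpace (IB := 𝓘(ℝ, E))).1 hZ).2)).congr_of_eventuallyEq ?_
  filter_upwards [eventually_mem_chart_source hV] with x hx
  exact cartanTensor_eq_localRep hx _ _ _ _

end AlongMaps

section Pointwise

variable {L : TangentBundle 𝓘(ℝ, E) M → ℝ} {v : TangentBundle 𝓘(ℝ, E) M}

theorem fundamentalTensor_symm (hL : ContMDiffAt 𝓘(ℝ, E).tangent 𝓘(ℝ, ℝ) ∞ L v) (u w : E) :
    fundamentalTensor L v u w = fundamentalTensor L v w u :=
  congrArg ((1 / 2 : ℝ) * ·) ((((contDiffAt_fibre hL).of_le (m := 2)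
    (by exact ENat.LEInfty.out)).isSymmSndFDerivAt (by simp)).eq u w)

theorem cartanTensor_swap_left (hL : ContMDiffAt 𝓘(ℝ, E).tangent 𝓘(ℝ, ℝ) ∞ L v) (a b c : E) :
    cartanTensor L v a b c = cartanTensor L v b a c :=
  congrArg ((1 / 4 : ℝ) * ·) (fderiv_fderiv_fderiv_swap_left
    ((contDiffAt_fibre hL).of_le (by exact ENat.LEInfty.out)) a b c)

theorem cartanTensor_swap_right (hL : ContMDiffAt 𝓘(ℝ, E).tangent 𝓘(ℝ, ℝ) ∞ L v) (a b c : E) :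
    cartanTensor L v a b c = cartanTensor L v a c b :=
  congrArg ((1 / 4 : ℝ) * ·) (fderiv_fderiv_fderiv_swap_right
    ((contDiffAt_fibre hL).of_le (by exact ENat.LEInfty.out)) a b c)

namespace FinslerSpacetime

variable (S : FinslerSpacetime E M)

theorem contMDiffAt_L (hv : v ∈ slitClosure S.A) :
    ContMDiffAt 𝓘(ℝ, E).tangent 𝓘(ℝ, ℝ) ∞ S.L v := by
  obtain ⟨Ω, hΩ, hsub, h⟩ := S.smooth_L
  exact h.contMDiffAt (hΩ.mem_nhds (hsub hv))

theorem subset_slitClosure : S.A ⊆ slitClosure S.A :=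
  fun v hv => ⟨subset_closure hv, S.ne_zero v hv⟩

theorem contDiffAt_fibre_of_mem (hv : v ∈ S.A) : ContDiffAt ℝ ∞ (fun y : E => S.L ⟨v.1, y⟩) v.2 :=
  contDiffAt_fibre (S.contMDiffAt_L (S.subset_slitClosure hv))

theorem eventually_homogeneous_fibre (hv : v ∈ S.A) :
    ∀ᶠ y : E in 𝓝 v.2, ∀ c : ℝ, 0 < c → S.L ⟨v.1, c • y⟩ = c ^ 2 • S.L ⟨v.1, y⟩ := by
  have hA : IsOpen {y : E | (⟨v.1, y⟩ : TangentBundle 𝓘(ℝ, E) M) ∈ S.A} :=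
    S.isOpen_A.preimage (FiberBundle.continuous_totalSpaceMk E (TangentSpace 𝓘(ℝ, E)) v.1)
  filter_upwards [hA.mem_nhds hv] with y hy
  exact S.homogeneous_L _ (S.subset_slitClosure hy)

theorem fundamentalTensor_self_of_mem (hv : v ∈ S.A) :
    fundamentalTensor S.L v v.2 v.2 = S.L v :=
  (congrArg ((1 / 2 : ℝ) * ·) (fderiv_fderiv_apply_self_of_homogeneous
    ((S.contDiffAt_fibre_of_mem hv).of_le (by exact ENat.LEInfty.out))
    (S.eventually_homogeneous_fibre hv))).trans
    (by ring : (1 / 2 : ℝ) * (2 * S.L v) = S.L v)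

theorem cartanTensor_self_of_mem (hv : v ∈ S.A) (a b : E) : cartanTensor S.L v v.2 a b = 0 :=
  (congrArg ((1 / 4 : ℝ) * ·) (congr($(fderiv_fderiv_fderiv_apply_self_of_homogeneous
    ((S.contDiffAt_fibre_of_mem hv).of_le (by exact ENat.LEInfty.out))
    (S.eventually_homogeneous_fibre hv)) a b))).trans (mul_zero _)

theorem eq_of_continuousAt {F G : TangentBundle 𝓘(ℝ, E) M → ℝ} (hv : v ∈ slitClosure S.A)
    (hF : ContinuousAt F v) (hG : ContinuousAt G v) (h : ∀ w ∈ S.A, F w = G w) : F v = G v :=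
  tendsto_nhds_unique_of_frequently_eq hF hG ((mem_closure_iff_frequently.1 hv.1).mono h)

theorem fundamentalTensor_self (hv : v ∈ slitClosure S.A) :
    fundamentalTensor S.L v v.2 v.2 = S.L v :=
  have hL := S.contMDiffAt_L hv
  S.eq_of_continuousAt hv
    (contMDiffAt_fundamentalTensor (V := id) hL contMDiffAt_id contMDiffAt_id
      contMDiffAt_id).continuousAt hL.continuousAt fun _ => S.fundamentalTensor_self_of_mem

theorem cartanTensor_self (hv : v ∈ slitClosure S.A) (a b : E) :
    cartanTensor S.L v v.2 a b = 0 := by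
  have hext (c : TangentSpace 𝓘(ℝ, E) v.1) : ContMDiffAt 𝓘(ℝ, E).tangent 𝓘(ℝ, E).tangent ∞
      (fun w : TangentBundle 𝓘(ℝ, E) M =>
        (⟨w.1, FiberBundle.extend E c w.1⟩ : TangentBundle 𝓘(ℝ, E) M)) v :=
    (FiberBundle.contMDiffAt_extend 𝓘(ℝ, E) E c).comp v (contMDiffAt_proj _)
  have h := S.eq_of_continuousAt hv (contMDiffAt_cartanTensor (V := id) (S.contMDiffAt_L hv)
    contMDiffAt_id contMDiffAt_id (hext a) (hext b)).continuousAt continuousAt_const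
    fun w hw => S.cartanTensor_self_of_mem hw _ _
  have hself (c : TangentSpace 𝓘(ℝ, E) v.1) : FiberBundle.extend E c v.1 = c :=
    FiberBundle.extend_apply_self E c
  exact (congrArg₂ (fun a b : E => cartanTensor S.L v v.2 a b) (hself a) (hself b)).symm.trans h

end FinslerSpacetime

end Pointwise

namespace HasLorentzSignature

variable {b : E →L[ℝ] E →L[ℝ] ℝ}

theorem eq_zero_of_forall (hb : HasLorentzSignature b) (hsymm : ∀ x y, b x y = b y x) {x : E}
    (h : ∀ y, b x y = 0) : x = 0 := by
  obtain ⟨u, -, hneg⟩ := hb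
  by_contra hx
  exact (hneg x ((hsymm u x).trans (h u)) hx).ne (h x)

theorem neg_or_mem_span (hb : HasLorentzSignature b) (hsymm : ∀ x y, b x y = b y x) {n x : E}
    (hn : n ≠ 0) (hnn : b n n = 0) (hnx : b n x = 0) : b x x < 0 ∨ x ∈ Submodule.span ℝ {n} := by
  obtain ⟨u, -, hneg⟩ := hb
  have hun : b u n ≠ 0 := fun h => (hneg n h hn).ne hnn
  -- the component of `x` orthogonal to the timelike vector `u`, along `n`
  let y := x - (b u x / b u n) • n
  by_cases hy : y = 0
  · exact .inr (Submodule.mem_span_singleton.2 ⟨_, (sub_eq_zero.1 hy).symm⟩)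
  · have huy : b u y = 0 := by simp [y, hun]
    left
    simpa [y, hnn, hnx, hsymm x n] using hneg y huy hy

end HasLorentzSignature

/-! ### Existence of the Levi-Civita–Chern connection -/

section AlmostCompatible

variable [FiniteDimensional ℝ E] [T2Space M]
  {B : LinearMap.BilinForm (SmoothFun E U) (VectorFields E U)}
  {C : VectorFields E U →ₗ[SmoothFun E U] LinearMap.BilinForm (SmoothFun E U) (VectorFields E U)}
  {V : VectorFields E U}

/-- The endomorphism `X ↦ ∇_X V` for the Levi-Civita–Chern connection `∇` of `V` with metric `B` and
Cartan tensor `C`. The Koszul formula for `∇` involves `∇_V V` and `∇_X V` through `C`; since `C`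
vanishes on `V`, it first gives `∇_V V`, which is that of the Levi-Civita connection of `B`, and
then `∇_X V`. -/
def chernDerivative (hB : IsPointwiseNondegenerate B) (hsymm : B.IsSymm)
    (C : VectorFields E U →ₗ[SmoothFun E U] LinearMap.BilinForm (SmoothFun E U) (VectorFields E U))
    (V : VectorFields E U) : VectorFields E U →ₗ[SmoothFun E U] VectorFields E U where
  toFun X := hB.koszulConnection 0 X V - hB.sharp (C (hB.koszulConnection 0 V V) X)
  map_add' X Y := by
    rw [(hB.isLinearConnection_koszulConnection hsymm).add_left, map_add, map_add]
    abel
  map_smul' f X := by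
    rw [(hB.isLinearConnection_koszulConnection hsymm).smul_left, map_smul, map_smul, smul_sub,
      RingHom.id_apply]

theorem chernDerivative_self (hB : IsPointwiseNondegenerate B) (hsymm : B.IsSymm)
    (hCswap : ∀ X Y, C X Y = C Y X) (hCV : C V = 0) :
    chernDerivative hB hsymm C V V = hB.koszulConnection 0 V V := by
  change hB.koszulConnection 0 V V - hB.sharp (C (hB.koszulConnection 0 V V) V) = _
  rw [hCswap, hCV, LinearMap.zero_apply, map_zero, sub_zero]

set_option maxSynthPendingDepth 3 in
/-- The tensor by which the Levi-Civita–Chern connection differs from the Levi-Civita connection of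
its metric, when `Q(X, Y, Z) = C(∇_X V, Y, Z)`. -/
def chernDifference
    (Q : VectorFields E U →ₗ[SmoothFun E U]
      LinearMap.BilinForm (SmoothFun E U) (VectorFields E U)) :
    VectorFields E U →ₗ[SmoothFun E U] LinearMap.BilinForm (SmoothFun E U) (VectorFields E U) :=
  LinearMap.lflip.comp Q.flip - Q - Q.flip

theorem exists_almostCompatible_connection (hB : IsPointwiseNondegenerate B) (hsymm : B.IsSymm)
    (hCswap : ∀ X Y, C X Y = C Y X) (hCsymm : ∀ X, (C X).IsSymm) (hCV : C V = 0) :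
    ∃ D, IsLinearConnection D ∧ (∀ X Y, D X Y - D Y X = lieBracket X Y) ∧
      ∀ X Y Z, dirDeriv X (B Y Z) = B (D X Y) Z + B Y (D X Z) + (2 : ℝ) • C (D X V) Y Z := by
  let A := chernDerivative hB hsymm C V
  let T := chernDifference (C.comp A)
  have hT (X Y Z) : T X Y Z = C (A Z) X Y - C (A X) Y Z - C (A Y) X Z := rfl
  have hTV (X Z) : T X V Z = -C (hB.koszulConnection 0 V V) X Z := by
    have hzero (W Y) : C W V Y = 0 := by rw [hCswap, hCV]; rfl
    rw [hT, (hCsymm _).eq, hzero, hzero, chernDerivative_self hB hsymm hCswap hCV]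
    simp
  have hDV (X) : hB.koszulConnection T X V = A X := hB.injective <| LinearMap.ext fun Z => by
    change _ = B (hB.koszulConnection 0 X V - hB.sharp (C (hB.koszulConnection 0 V V) X)) Z
    rw [map_sub, LinearMap.sub_apply, hB.apply_sharp, hB.koszulConnection_apply,
      hB.koszulConnection_apply, hTV]
    simp [sub_eq_add_neg]
  refine ⟨hB.koszulConnection T, hB.isLinearConnection_koszulConnection hsymm,
    hB.koszulConnection_torsionFree hsymm fun X Y => LinearMap.ext fun Z => ?_, fun X Y Z => ?_⟩
  · rw [hT, hT, (hCsymm _).eq X Y]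
    ring
  · rw [hB.dirDeriv_eq_koszulConnection hsymm, hDV, hT, hT, (hCsymm _).eq Z Y, two_smul]
    ring

end AlmostCompatible

namespace FinslerSpacetime

variable {S : FinslerSpacetime E M} {V : VectorFields E U}

theorem IsAdmissible.contMDiffAt_L (hV : S.IsAdmissible V) {p : M} (hp : p ∈ U) :
    ContMDiffAt 𝓘(ℝ, E).tangent 𝓘(ℝ, ℝ) ∞ S.L ⟨p, V p⟩ :=
  S.contMDiffAt_L (hV p hp)

/-- The metric `g_V` as a bilinear form on vector fields. -/
def metric (hV : S.IsAdmissible V) : LinearMap.BilinForm (SmoothFun E U) (VectorFields E U) :=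
  LinearMap.mk₂ (SmoothFun E U)
    (fun X Y => .mk (fun p => S.g V p (X p) (Y p)) fun _ hp => contMDiffAt_fundamentalTensor
      (hV.contMDiffAt_L hp) (V.contMDiffAt hp) (X.contMDiffAt hp) (Y.contMDiffAt hp))
    (fun X X' Y => SmoothFun.ext fun p => LinearMap.map_add₂ (S.g V p) (X p) (X' p) (Y p))
    (fun f X Y => SmoothFun.ext fun p => LinearMap.map_smul₂ (S.g V p) (f p) (X p) (Y p))
    (fun X Y Y' => SmoothFun.ext fun p => map_add (S.g V p (X p)) (Y p) (Y' p))
    (fun f X Y => SmoothFun.ext fun p => map_smul (S.g V p (X p)) (f p) (Y p))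

theorem IsAdmissible.g_symm (hV : S.IsAdmissible V) {p : M} (hp : p ∈ U)
    (x y : TangentSpace 𝓘(ℝ, E) p) : S.g V p x y = S.g V p y x :=
  fundamentalTensor_symm (hV.contMDiffAt_L hp) x y

theorem isSymm_metric (hV : S.IsAdmissible V) : (metric hV).IsSymm where
  eq X Y := by
    ext p
    by_cases hp : p ∈ U
    · exact hV.g_symm hp _ _
    · exact (linearMap_apply_of_notMem _ hp _).trans (linearMap_apply_of_notMem _ hp _).symm

theorem isPointwiseNondegenerate_metric [FiniteDimensional ℝ E] [T2Space M]
    (hV : S.IsAdmissible V) : IsPointwiseNondegenerate (metric hV) := by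
  refine fun p hp X h => (S.signature _ (hV p hp)).eq_zero_of_forall (hV.g_symm hp) fun y => ?_
  obtain ⟨Y, rfl⟩ := exists_vectorFields_apply_eq hp y
  exact h Y

set_option maxSynthPendingDepth 3 in
/-- The Cartan tensor `C_V` as a trilinear form on vector fields. -/
def cartan (hV : S.IsAdmissible V) :
    VectorFields E U →ₗ[SmoothFun E U] LinearMap.BilinForm (SmoothFun E U) (VectorFields E U) :=
  LinearMap.mk₂ (SmoothFun E U)
    (fun X Y =>
      { toFun := fun Z => .mk (fun p => S.C V p (X p) (Y p) (Z p)) fun _ hp =>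
          contMDiffAt_cartanTensor (hV.contMDiffAt_L hp) (V.contMDiffAt hp) (X.contMDiffAt hp)
            (Y.contMDiffAt hp) (Z.contMDiffAt hp)
        map_add' := fun Z Z' => SmoothFun.ext fun p =>
          map_add (cartanTensor S.L ⟨p, V p⟩ (X p) (Y p)) (Z p) (Z' p)
        map_smul' := fun f Z => SmoothFun.ext fun p =>
          map_smul (cartanTensor S.L ⟨p, V p⟩ (X p) (Y p)) (f p) (Z p) })
    (fun X X' Y => LinearMap.ext fun Z => SmoothFun.ext fun p =>
      congr($(map_add (cartanTensor S.L ⟨p, V p⟩) (X p) (X' p)) (Y p) (Z p)))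
    (fun f X Y => LinearMap.ext fun Z => SmoothFun.ext fun p =>
      congr($(map_smul (cartanTensor S.L ⟨p, V p⟩) (f p) (X p)) (Y p) (Z p)))
    (fun X Y Y' => LinearMap.ext fun Z => SmoothFun.ext fun p =>
      congr($(map_add (cartanTensor S.L ⟨p, V p⟩ (X p)) (Y p) (Y' p)) (Z p)))
    (fun f X Y => LinearMap.ext fun Z => SmoothFun.ext fun p =>
      congr($(map_smul (cartanTensor S.L ⟨p, V p⟩ (X p)) (f p) (Y p)) (Z p)))

theorem isSymm_cartan (hV : S.IsAdmissible V) (X : VectorFields E U) : (cartan hV X).IsSymm where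
  eq Y Z := by
    ext p
    by_cases hp : p ∈ U
    · exact cartanTensor_swap_right (hV.contMDiffAt_L hp) _ _ _
    · exact (linearMap_apply_of_notMem _ hp _).trans (linearMap_apply_of_notMem _ hp _).symm

theorem cartan_swap_left (hV : S.IsAdmissible V) (X Y : VectorFields E U) :
    cartan hV X Y = cartan hV Y X := by
  ext Z p
  by_cases hp : p ∈ U
  · exact cartanTensor_swap_left (hV.contMDiffAt_L hp) _ _ _
  · exact (linearMap_apply_of_notMem _ hp _).trans (linearMap_apply_of_notMem _ hp _).symm

theorem cartan_self (hV : S.IsAdmissible V) : cartan hV V = 0 := by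
  ext X Y p
  by_cases hp : p ∈ U
  · exact S.cartanTensor_self (hV p hp) _ _
  · exact linearMap_apply_of_notMem _ hp _

variable [FiniteDimensional ℝ E] [T2Space M]

theorem isChernConnection_chern (hV : S.IsAdmissible V) :
    S.IsChernConnection V (S.chern V) := by
  obtain ⟨D, linear, torsion_free, almost_compatible⟩ := exists_almostCompatible_connection
    (isPointwiseNondegenerate_metric hV) (isSymm_metric hV) (cartan_swap_left hV)
    (isSymm_cartan hV) (cartan_self hV)
  exact Classical.epsilon_spec
    ⟨D, linear, torsion_free, fun X Y Z p _ => congr($(almost_compatible X Y Z) p)⟩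

theorem isLeviCivita_chern (hV : S.IsAdmissible V) (hpar : S.IsParallel V) :
    IsLeviCivita (metric hV) (S.chern V) where
  isSymm := isSymm_metric hV
  linear := (isChernConnection_chern hV).linear
  torsion_free := (isChernConnection_chern hV).torsion_free
  metric X Y Z := by
    ext p
    by_cases hp : p ∈ U
    · have hC : cartan hV (S.chern V X V) Y Z p = 0 := by
        rw [hpar X, map_zero]
        rfl
      have h : dirDeriv X (metric hV Y Z) p = metric hV (S.chern V X Y) Z p +
          metric hV Y (S.chern V X Z) p + 2 * cartan hV (S.chern V X V) Y Z p :=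
        (isChernConnection_chern hV).almost_compatible X Y Z p hp
      rwa [hC, mul_zero, add_zero] at h
    · rw [dirDeriv_apply_eq_zero (X.eq_zero p hp), SmoothFun.add_apply,
        linearMap_apply_of_notMem _ hp, linearMap_apply_of_notMem _ hp, add_zero]

end FinslerSpacetime

/-! ### The quotient bundle of a parallel lightlike field -/

namespace FinslerSpacetime

variable {S : FinslerSpacetime E M} {N : VectorFields E U}

/-- The bilinear form `ḡ([x], [y]) = -g_N(x, y)` on the fibre of `N^⊥/N` at `p`. -/
def quotMetric (hN : S.IsAdmissible N) (p : U) : LinearMap.BilinForm ℝ (S.QuotFibre N p) :=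
  LinearMap.IsRefl.liftQ₂ (-(S.g N p).restrict (S.PerpFibre N p)) _
    (fun x y h => (congrArg Neg.neg (hN.g_symm p.2 (y : TangentSpace 𝓘(ℝ, E) (p : M)) x)).trans h)
    fun x hx => LinearMap.ext fun y => neg_eq_zero.2 <| by
      obtain ⟨c, hc⟩ := Submodule.mem_span_singleton.1 (Submodule.mem_comap.1 hx)
      have hx : (x : TangentSpace 𝓘(ℝ, E) (p : M)) = c • N p := hc.symm
      rw [LinearMap.BilinForm.restrict_apply, LinearMap.domRestrict_apply, hx,
        LinearMap.map_smul₂, LinearMap.mem_ker.1 y.2, smul_zero]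

theorem quotMetric_mk (hN : S.IsAdmissible N) (p : U) (x y : S.PerpFibre N p) :
    quotMetric hN p (Submodule.Quotient.mk x) (Submodule.Quotient.mk y) = -S.g N p x y := rfl

theorem quotMetric_symm (hN : S.IsAdmissible N) (p : U) (ξ η : S.QuotFibre N p) :
    quotMetric hN p ξ η = quotMetric hN p η ξ := by
  obtain ⟨x, rfl⟩ := Submodule.Quotient.mk_surjective _ ξ
  obtain ⟨y, rfl⟩ := Submodule.Quotient.mk_surjective _ η
  exact congrArg Neg.neg (hN.g_symm p.2 x y)

theorem quotMetric_pos (hN : S.IsLightlike N) (p : U) {ξ : S.QuotFibre N p} (hξ : ξ ≠ 0) :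
    0 < quotMetric hN.1 p ξ ξ := by
  obtain ⟨x, rfl⟩ := Submodule.Quotient.mk_surjective _ ξ
  have hNp := hN.1 p p.2
  have hnull := (S.fundamentalTensor_self hNp).trans (hN.2 p p.2)
  rw [quotMetric_mk, neg_pos]
  refine ((S.signature _ hNp).neg_or_mem_span (hN.1.g_symm p.2) hNp.2 hnull
    (LinearMap.mem_ker.1 x.2)).resolve_right fun hx => hξ ?_
  exact (Submodule.Quotient.mk_eq_zero _).2 (Submodule.mem_comap.2 hx)

theorem mem_perp_iff (hN : S.IsAdmissible N) {X : VectorFields E U} :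
    X ∈ S.Perp N ↔ metric hN N X = 0 := by
  refine ⟨fun h => SmoothFun.ext fun p => ?_, fun h p _ => congr($h p)⟩
  by_cases hp : p ∈ U
  · exact h p hp
  · exact linearMap_apply_of_notMem _ hp X

variable [FiniteDimensional ℝ E] [T2Space M]

theorem chern_mem_perp (hN : S.IsAdmissible N) (hpar : S.IsParallel N) (W : VectorFields E U) :
    ∀ Y ∈ S.Perp N, S.chern N W Y ∈ S.Perp N := fun _ hY =>
  (mem_perp_iff hN).2 <|
    (isLeviCivita_chern hN hpar).apply_apply_eq_zero_of_parallel hpar ((mem_perp_iff hN).1 hY) W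

theorem curvature_chern_mem_span_iff (hN : S.IsAdmissible N) (hpar : S.IsParallel N) :
    (∀ X Y, ∀ Z ∈ S.Perp N,
        curvature (S.chern N) X Y Z ∈ Submodule.span (SmoothFun E U) {N}) ↔
      ∀ X ∈ S.Perp N, ∀ Y ∈ S.Perp N, ∀ Z ∈ S.Perp N, curvature (S.chern N) X Y Z = 0 := by
  simp only [mem_perp_iff hN]
  exact (isLeviCivita_chern hN hpar).curvature_mem_span_singleton_iff
    (isPointwiseNondegenerate_metric hN) fun p hp => (hN p hp).2

end FinslerSpacetime

end FinslerPP

end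

open FinslerPP FinslerSpacetime in
theorem theorem5p1_general
    {E : Type*} [NormedAddCommGroup E] [NormedSpace ℝ E] [FiniteDimensional ℝ E]
    {M : Type*} [TopologicalSpace M] [ChartedSpace E M] [IsManifold 𝓘(ℝ, E) ∞ M] [T2Space M]
    (S : FinslerSpacetime E M) (U : Opens M) (N : VectorFields E U)
    (hlight : S.IsLightlike N) (hpar : S.IsParallel N) :
    (∃ gbar : (p : U) → LinearMap.BilinForm ℝ (S.QuotFibre N p),
      (∀ (p : U) (x y : S.PerpFibre N p),
        gbar p (Submodule.Quotient.mk x) (Submodule.Quotient.mk y) = -S.g N p x y) ∧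
      (∀ p ξ η, gbar p ξ η = gbar p η ξ) ∧
      (∀ p ξ, ξ ≠ 0 → 0 < gbar p ξ ξ) ∧
      (∀ X ∈ S.Perp N, ∀ Y ∈ S.Perp N,
        ContMDiffOn 𝓘(ℝ, E) 𝓘(ℝ, ℝ) ∞ (fun p => -S.g N p (X p) (Y p)) U)) ∧
    (∃ Dbar : VectorFields E U → S.QuotSections N → S.QuotSections N,
      IsLinearConnection Dbar ∧
      (∀ (W : VectorFields E U) (Y : S.Perp N),
        ∃ h : S.chern N W Y ∈ S.Perp N,
          Dbar W (Submodule.Quotient.mk Y) = Submodule.Quotient.mk ⟨S.chern N W Y, h⟩) ∧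
      (IsFlat Dbar ↔ ∀ X ∈ S.Perp N, ∀ Y ∈ S.Perp N, ∀ Z ∈ S.Perp N,
        curvature (S.chern N) X Y Z = 0)) := by
  have hN := hlight.1
  have hchern := (isLeviCivita_chern hN hpar).linear
  have hperp := chern_mem_perp hN hpar
  have hrestrict := hchern.isLinearConnection_restrict hperp
  have hspan : ∀ W, ∀ Y ∈ (Submodule.span (SmoothFun E U) {N}).submoduleOf (S.Perp N),
      IsLinearConnection.restrict hperp W Y ∈
        (Submodule.span (SmoothFun E U) {N}).submoduleOf (S.Perp N) :=
    fun W Y hY => hchern.mem_span_singleton_of_parallel hpar hY W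
  refine ⟨⟨quotMetric hN, quotMetric_mk hN,
    quotMetric_symm hN, fun p _ => quotMetric_pos hlight p,
    fun X _ Y _ => (-metric hN X Y).2⟩,
    hrestrict.quotient hspan, hrestrict.isLinearConnection_quotient hspan,
    fun W Y => ⟨hperp W Y Y.2, hrestrict.quotient_mk hspan W Y⟩, ?_⟩
  rw [hrestrict.isFlat_quotient_iff hspan, ← curvature_chern_mem_span_iff hN hpar]
  exact forall₂_congr fun X Y => Subtype.forall

open FinslerPP in
theorem theorem5p1
    {E : Type*} [NormedAddCommGroup E] [NormedSpace ℝ E] [FiniteDimensional ℝ E]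
    {M : Type*} [TopologicalSpace M] [ChartedSpace E M] [IsManifold 𝓘(ℝ, E) ∞ M]
    [T2Space M] [SecondCountableTopology M] [ConnectedSpace M]
    (S : FinslerSpacetime E M) (U : Opens M)
    (f : SmoothFun E U) (N : VectorFields E U)
    (hgrad : S.IsGradient f N) (hlight : S.IsLightlike N) (hpar : S.IsParallel N) :
    -- the positive definite metric `ḡ([x], [y]) = -g_N(x, y)` on the bundle `N^⊥/N`
    (∃ gbar : (p : U) → LinearMap.BilinForm ℝ (S.QuotFibre N p),
      (∀ (p : U) (x y : S.PerpFibre N p),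
        gbar p (Submodule.Quotient.mk x) (Submodule.Quotient.mk y) = -S.g N p x y) ∧
      (∀ p ξ η, gbar p ξ η = gbar p η ξ) ∧
      (∀ p ξ, ξ ≠ 0 → 0 < gbar p ξ ξ) ∧
      -- the metric is smooth on sections
      (∀ X ∈ S.Perp N, ∀ Y ∈ S.Perp N,
        ContMDiffOn 𝓘(ℝ, E) 𝓘(ℝ, ℝ) ∞ (fun p => -S.g N p (X p) (Y p)) U)) ∧
    -- the connection `∇̄_W [Y] = [∇^N_W Y]` on the bundle `N^⊥/N`
    (∃ Dbar : VectorFields E U → S.QuotSections N → S.QuotSections N,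
      IsLinearConnection Dbar ∧
      (∀ (W : VectorFields E U) (Y : S.Perp N),
        ∃ h : S.chern N W Y ∈ S.Perp N,
          Dbar W (Submodule.Quotient.mk Y) = Submodule.Quotient.mk ⟨S.chern N W Y, h⟩) ∧
      (IsFlat Dbar ↔ S.IsPPWave N)) := by
  obtain ⟨hmetric, Dbar, hDbar, hmk, hflat⟩ := theorem5p1_general S U N hlight hpar
  exact ⟨hmetric, Dbar, hDbar, hmk, hflat.trans ⟨(⟨⟨f, hgrad⟩, hlight, hpar, ·⟩), (·.2.2.2)⟩⟩
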